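/- Let $G=\mathrm{SL}(2)\times\mathrm{SL}(2)\times\mathrm{SL}(2)$ over $\mathbb C$, let $\mathbb C[G]$ be its coordinate ring, and let $A=\mathbb C[G]^{\operatorname{diag}\mathrm{SL}(2)}$ be the ring of regular functions on $G$ invariant under right translation by the diagonal subgroup, on which $G$ acts by left translation. For $k\in\mathbb N$ let $V(k)=\mathrm{Sym}^k\mathbb C^2$ be the simple $\mathrm{SL}(2)$-module of highest weight $k$, and for $m=(m_0,m_1,m_2)\in\mathbb N^3$ let $V(m)=V(m_0)\otimes V(m_1)\otimes V(m_2)$ be the corresponding simple $G$-module. Let $$T=\{m\in\mathbb N^3 : V(m_2)\subset V(m_0)\otimes V(m_1)\}$$ be the tensor semigroup of $\mathrm{SL}(2)$, and write $n\le m$ if all the differences $m_i-n_i$ are nonnegative and even. (1) The isotypic component of type $V(m)$ in $A$ is isomorphic to $V(m)$ for each $m\in T$. Denoting it again by $V(m)$, one has $A=\bigoplus_{m\in T}V(m)$. For $m\in\mathbb N^3$ put $\Gamma(m)=\bigoplus_{n\in T,\ n\le m}V(n)\subset A$. (2) If $m,n\in T$, then $m+n\in T$ and $\Gamma(m)\cdot\Gamma(n)=\Gamma(m+n)$,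 where the left hand side is the linear span of the products. Let $H=(Z\times Z\times Z)\operatorname{diag}\mathrm{SL}(2)$, with $Z$ the centre of $\mathrm{SL}(2)$, and let $X$ be the wonderful compactification of $G/H$ (the wonderful variety with spherical system $\mathsf{a^x}(1,1,1)$), realised as follows. Let $g\in G$ act on triples of $2\times2$ matrices by $A_i\mapsto g_{i+1}A_ig_{i+2}^{-1}$ (indices modulo $3$); then $X$ is the Zariski closure in $\mathbb P(\mathrm{Mat}_2)^3$ of the $G$-orbit of $([1],[1],[1])$, a point whose stabiliser is $H$. For $d=(d_0,d_1,d_2)\in\mathbb N^3$ let $\mathcal L_d$ be the restriction to $X$ of $\mathcal O(d_0)\boxtimes\mathcal O(d_1)\boxtimes\mathcal O(d_2)$ (these are the globally generated line bundles on $X$), and let $\omega(d)=(d_1+d_2,\;d_2+d_0,\;d_0+d_1)$ be its weight. Its sections are the regular functions of the homogeneous coordinates of the points of $X$ that are homogeneous of degree $d_i$ in the $i$-th matrix. (3) $\omega(\mathbb N^3)=T$, and for every $d\in\mathbb N^3$ the pullback of sections along $G\to X$, $g\mapsto g\cdot([1],[1],[1])$, with homogeneous coordinates $(g_{i+1}g_{i+2}^{-1})_i$,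 maps $\Gamma(X,\mathcal L_d)$ isomorphically onto $\Gamma(\omega(d))$. (4) For all $d,e\in\mathbb N^3$ the multiplication of sections $\Gamma(X,\mathcal L_d)\otimes\Gamma(X,\mathcal L_e)\to\Gamma(X,\mathcal L_{d+e})$ is surjective. -/

import Mathlib

open scoped LinearAlgebra.Projectivization

noncomputable section

namespace TripleSL2

/-! ### The groups and their simple modules -/

/-- The group `SL(2)` over the complex numbers. -/
abbrev SL2 : Type := Matrix.SpecialLinearGroup (Fin 2) ℂ

/-- The group `G = SL(2) × SL(2) × SL(2)`. -/
abbrev G : Type := Fin 3 → SL2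

/-- The linear substitution `X_j ↦ ∑ i, g_{ij} X_i` on polynomials in two variables. -/
def subst (g : SL2) : MvPolynomial (Fin 2) ℂ →ₐ[ℂ] MvPolynomial (Fin 2) ℂ :=
  MvPolynomial.aeval fun j => ∑ i, MvPolynomial.C (g.1 i j) * MvPolynomial.X i

theorem subst_one : subst 1 = AlgHom.id ℂ _ := by
  refine MvPolynomial.algHom_ext fun j => ?_
  fin_cases j <;> simp [subst, Matrix.one_apply]

theorem subst_mul (g h : SL2) : subst (g * h) = (subst g).comp (subst h) := by
  refine MvPolynomial.algHom_ext fun j => ?_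
  simp only [subst, AlgHom.comp_apply, MvPolynomial.aeval_X, map_mul,
    MvPolynomial.algHom_C, Matrix.SpecialLinearGroup.coe_mul, Matrix.mul_apply, Fin.sum_univ_two,
    MvPolynomial.algebraMap_eq, map_add]
  ring

theorem subst_mem (k : ℕ) (g : SL2) (p : MvPolynomial (Fin 2) ℂ)
    (hp : p ∈ MvPolynomial.homogeneousSubmodule (Fin 2) ℂ k) :
    (subst g).toLinearMap p ∈ MvPolynomial.homogeneousSubmodule (Fin 2) ℂ k := by
  rw [MvPolynomial.mem_homogeneousSubmodule] at hp ⊢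
  have := hp.aeval (n := 1) (fun j => ∑ i, MvPolynomial.C (g.1 i j) * MvPolynomial.X i)
    (fun j => MvPolynomial.IsHomogeneous.sum _ _ _ fun i _ => by
      simpa using (MvPolynomial.isHomogeneous_C (Fin 2) (g.1 i j)).mul
        (MvPolynomial.isHomogeneous_X ℂ i))
  simpa [subst] using this

/-- The underlying space of the simple `SL(2)`-module `V(k)`: binary forms of degree `k`. -/
abbrev BinForm (k : ℕ) : Type := MvPolynomial.homogeneousSubmodule (Fin 2) ℂ k

/-- The simple `SL(2)`-module `V(k)` of highest weight `k`, realised as `Sym^k` of the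
standard representation. -/
def simpleSL2 (k : ℕ) : Representation ℂ SL2 (BinForm k) where
  toFun g := (subst g).toLinearMap.restrict (subst_mem k g)
  map_one' := by
    ext p : 2
    simp [subst_one]
  map_mul' g h := by
    ext p : 2
    simp [subst_mul]

/-- The simple `G`-module `V(m) = V(m₀) ⊗ V(m₁) ⊗ V(m₂)`, where the `i`-th factor of `G`
acts on the `i`-th tensor factor. -/
def simpleG (m : Fin 3 → ℕ) :
    Representation ℂ G
      (TensorProduct ℂ (BinForm (m 0)) (TensorProduct ℂ (BinForm (m 1)) (BinForm (m 2)))) :=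
  Representation.tprod ((simpleSL2 (m 0)).comp (Pi.evalMonoidHom (fun _ : Fin 3 => SL2) 0))
    (Representation.tprod ((simpleSL2 (m 1)).comp (Pi.evalMonoidHom (fun _ : Fin 3 => SL2) 1))
      ((simpleSL2 (m 2)).comp (Pi.evalMonoidHom (fun _ : Fin 3 => SL2) 2)))

/-- The tensor semigroup of `SL(2)`: the triples `m` with `V(m₂) ⊂ V(m₀) ⊗ V(m₁)`. -/
def tensorSemigroup : Set (Fin 3 → ℕ) :=
  {m | ∃ f : Representation.IntertwiningMap (simpleSL2 (m 2))
      (Representation.tprod (simpleSL2 (m 0)) (simpleSL2 (m 1))), Function.Injective f}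

/-- The order given by even nonnegative differences: `n ≤ m` iff every `mᵢ - nᵢ` is a
nonnegative even number. -/
def EvenLE (n m : Fin 3 → ℕ) : Prop := ∀ i, ∃ c : ℕ, m i = n i + 2 * c

/-! ### The coordinate ring and its invariants -/

/-- The coordinate ring `ℂ[G]`: polynomial functions in the matrix entries. -/
def coordRing : Subalgebra ℂ (G → ℂ) :=
  Algebra.adjoin ℂ {f | ∃ (i : Fin 3) (a b : Fin 2), f = fun g => (g i).1 a b}

/-- The ring `ℂ[G]^{diag SL(2)}` of regular functions on `G` that are invariant under right
translation by the diagonal subgroup. -/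
def invRing : Subalgebra ℂ (G → ℂ) where
  carrier := {f | f ∈ coordRing ∧ ∀ (g : G) (h : SL2), f (fun i => g i * h) = f g}
  mul_mem' := fun {a b} ha hb => ⟨mul_mem ha.1 hb.1, fun g h => by simp [ha.2 g h, hb.2 g h]⟩
  add_mem' := fun {a b} ha hb => ⟨add_mem ha.1 hb.1, fun g h => by simp [ha.2 g h, hb.2 g h]⟩
  algebraMap_mem' c := ⟨algebraMap_mem _ c, fun g h => by simp⟩

theorem translate_mem_coordRing (x : G) {f : G → ℂ} (hf : f ∈ coordRing) :
    (fun g => f (x * g)) ∈ coordRing := by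
  refine Algebra.adjoin_induction (p := fun f _ => (fun g : G => f (x * g)) ∈ coordRing)
    ?_ ?_ ?_ ?_ hf
  · rintro _ ⟨i, a, b, rfl⟩
    have h : (fun g : G => ((x * g) i).1 a b)
        = ∑ k, ((x i).1 a k) • (fun g : G => (g i).1 k b) := by
      funext g
      simp [Matrix.mul_apply]
    rw [h]
    refine sum_mem fun k _ => Subalgebra.smul_mem coordRing (x := fun g : G => (g i).1 k b) ?_ _
    exact Algebra.subset_adjoin ⟨i, k, b, rfl⟩
  · intro c
    exact algebraMap_mem coordRing c
  · intro f₁ f₂ _ _ h₁ h₂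
    exact add_mem h₁ h₂
  · intro f₁ f₂ _ _ h₁ h₂
    exact mul_mem h₁ h₂

theorem translate_mem_invRing (x : G) {f : G → ℂ} (hf : f ∈ invRing) :
    (fun g => f (x * g)) ∈ invRing :=
  ⟨translate_mem_coordRing x hf.1, fun g h => by
    simpa [Pi.mul_def, mul_assoc] using hf.2 (x * g) h⟩

/-- The action of `G` on `ℂ[G]^{diag SL(2)}` by left translation, `(x • f) g = f (x⁻¹ g)`. -/
def leftRep : Representation ℂ G invRing where
  toFun x :=
    { toFun := fun f => ⟨fun g => f.1 (x⁻¹ * g), translate_mem_invRing x⁻¹ f.2⟩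
      map_add' := fun _ _ => rfl
      map_smul' := fun _ _ => rfl }
  map_one' := by
    ext f g
    simp
  map_mul' x y := by
    ext f g
    simp [mul_assoc]

/-- The copy of `V(m)` inside `ℂ[G]^{diag SL(2)}`: the isotypic component of type `V(m)`, that
is, the sum of all the `G`-submodules isomorphic to `V(m)`. -/
def component (m : Fin 3 → ℕ) : Subrepresentation leftRep where
  toSubmodule := sSup {U | ∃ S : Subrepresentation leftRep, S.toSubmodule = U ∧
    Nonempty (S.toRepresentation.Equiv (simpleG m))}
  apply_mem_toSubmodule g v hv := by
    suffices h : sSup {U | ∃ S : Subrepresentation leftRep, S.toSubmodule = U ∧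
        Nonempty (S.toRepresentation.Equiv (simpleG m))} ≤
        (sSup {U | ∃ S : Subrepresentation leftRep, S.toSubmodule = U ∧
          Nonempty (S.toRepresentation.Equiv (simpleG m))}).comap (leftRep g) from h hv
    refine sSup_le ?_
    rintro _ ⟨S, rfl, hS⟩ v hv
    have hle : S.toSubmodule ≤ sSup {U | ∃ S : Subrepresentation leftRep, S.toSubmodule = U ∧
        Nonempty (S.toRepresentation.Equiv (simpleG m))} := le_sSup (by exact ⟨S, rfl, hS⟩)
    exact hle (S.apply_mem_toSubmodule g hv)

/-- `Γ(m)`, the sum of the `V(n)` over the `n ≤ m` in the tensor semigroup. -/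
def Gam (m : Fin 3 → ℕ) : Submodule ℂ invRing :=
  ⨆ n : {n : Fin 3 → ℕ // n ∈ tensorSemigroup ∧ EvenLE n m}, (component n.1).toSubmodule

/-! ### The wonderful compactification -/

/-- Two by two complex matrices. -/
abbrev Mat : Type := Matrix (Fin 2) (Fin 2) ℂ

theorem SL2.coe_ne_zero (g : SL2) : (g.1 : Mat) ≠ 0 := by
  intro h
  have := g.2
  rw [h] at this
  simp at this

/-- The `G`-orbit in `ℙ(Mat)³` of the point `([1], [1], [1])`, where `x ∈ G` acts by
`Aᵢ ↦ xᵢ₊₁ Aᵢ xᵢ₊₂⁻¹` (indices modulo `3`). The stabiliser of that point is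
`H = (Z × Z × Z) diag SL(2)`, with `Z` the centre of `SL(2)`. -/
def openOrbit : Set (Fin 3 → ℙ ℂ Mat) :=
  Set.range fun (x : G) (i : Fin 3) =>
    Projectivization.mk ℂ ((x (i + 1) * (x (i + 2))⁻¹ : SL2).1 : Mat) (SL2.coe_ne_zero _)

/-- Polynomials in the coordinates of a triple of matrices. -/
abbrev TriplePoly : Type := MvPolynomial (Fin 3 × Fin 2 × Fin 2) ℂ

/-- The value of a polynomial at a triple of matrices. -/
def evalTriple (A : Fin 3 → Mat) (p : TriplePoly) : ℂ :=
  MvPolynomial.eval (fun v => A v.1 v.2.1 v.2.2) p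

/-- `A` is a triple of homogeneous coordinates of the point `x` of `ℙ(Mat)³`. -/
def IsCoord (A : Fin 3 → Mat) (x : Fin 3 → ℙ ℂ Mat) : Prop :=
  ∀ i, ∃ h : A i ≠ 0, Projectivization.mk ℂ (A i) h = x i

/-- The variety `X`: the Zariski closure in `ℙ(Mat)³` of the open orbit. A point belongs to it
iff all the polynomials in the homogeneous coordinates that vanish on the orbit (for every
choice of coordinates) vanish at the point. -/
def wonderfulX : Set (Fin 3 → ℙ ℂ Mat) :=
  {x | ∀ p : TriplePoly,
    (∀ y ∈ openOrbit, ∀ B, IsCoord B y → evalTriple B p = 0) →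
      ∀ A, IsCoord A x → evalTriple A p = 0}

/-- The triples of homogeneous coordinates of the points of `X`. -/
def ConeX : Type := {A : Fin 3 → Mat // ∃ x ∈ wonderfulX, IsCoord A x}

/-- Sections over `X` of the line bundle `𝒪(d₀, d₁, d₂)`, the restriction to `X` of
`𝒪(d₀) ⊠ 𝒪(d₁) ⊠ 𝒪(d₂)` on `ℙ(Mat)³`: functions of the homogeneous coordinates that are
regular (locally a quotient of two polynomials) and homogeneous of degree `dᵢ` in the `i`-th
matrix. -/
def sectionsX (d : Fin 3 → ℕ) : Submodule ℂ (ConeX → ℂ) where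
  carrier := {s |
    (∀ A B : ConeX, ∀ t : Fin 3 → ℂ, (∀ i, B.1 i = t i • A.1 i) →
      s B = (∏ i, t i ^ d i) * s A) ∧
    ∀ A : ConeX, ∃ p q : TriplePoly, evalTriple A.1 q ≠ 0 ∧
      ∀ B : ConeX, evalTriple B.1 q ≠ 0 → s B = evalTriple B.1 p / evalTriple B.1 q}
  add_mem' := by
    rintro s₁ s₂ ⟨h₁, r₁⟩ ⟨h₂, r₂⟩
    refine ⟨fun A B t hB => ?_, fun A => ?_⟩
    · simp only [Pi.add_apply, h₁ A B t hB, h₂ A B t hB]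
      ring
    · obtain ⟨p₁, q₁, hq₁, e₁⟩ := r₁ A
      obtain ⟨p₂, q₂, hq₂, e₂⟩ := r₂ A
      refine ⟨p₁ * q₂ + p₂ * q₁, q₁ * q₂, ?_, fun B hB => ?_⟩
      · simpa [evalTriple] using And.intro hq₁ hq₂
      · simp only [evalTriple, map_mul, ne_eq, mul_eq_zero, not_or] at hB
        simp only [Pi.add_apply, e₁ B hB.1, e₂ B hB.2]
        simp only [evalTriple, map_mul, map_add]
        have h1 := hB.1
        have h2 := hB.2
        field_simp
  zero_mem' := ⟨fun _ _ _ _ => by simp, fun _ => ⟨0, 1, by simp [evalTriple], by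
    simp [evalTriple]⟩⟩
  smul_mem' := by
    rintro c s ⟨h, r⟩
    refine ⟨fun A B t hB => ?_, fun A => ?_⟩
    · simp only [Pi.smul_apply, smul_eq_mul, h A B t hB]
      ring
    · obtain ⟨p, q, hq, e⟩ := r A
      refine ⟨MvPolynomial.C c * p, q, hq, fun B hB => ?_⟩
      simp only [Pi.smul_apply, smul_eq_mul, e B hB]
      simp [evalTriple, mul_div_assoc]

/-- Homogeneous coordinates of the point `x • ([1], [1], [1])`. -/
def orbitMap (x : G) : ConeX :=
  ⟨fun i => (x (i + 1) * (x (i + 2))⁻¹ : SL2).1,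
    fun i => Projectivization.mk ℂ ((x (i + 1) * (x (i + 2))⁻¹ : SL2).1 : Mat)
      (SL2.coe_ne_zero _),
    fun _ hp A hA => hp _ ⟨x, rfl⟩ A hA, fun _ => ⟨SL2.coe_ne_zero _, rfl⟩⟩

/-- The restriction of a section to the open orbit, viewed as a function on `G`. -/
def pullback : (ConeX → ℂ) →ₗ[ℂ] (G → ℂ) := LinearMap.funLeft ℂ ℂ orbitMap

/-- The weight of the line bundle `𝒪(d₀, d₁, d₂)`. -/
def weight (d : Fin 3 → ℕ) : Fin 3 → ℕ := fun i => d (i + 1) + d (i + 2)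

end TripleSL2

end

/-!
The proof compares three descriptions of the same functions on `G = SL(2)³`: matrix coefficients of
the simple modules `V(m)`, polynomials in the entries of the three matrices `gᵢ`, and polynomials in
the entries of the homogeneous coordinates `gᵢ₊₁ gᵢ₊₂⁻¹` of the points of the open orbit.

*Invariants.* Elements of `V(m)` are tested on the pure powers `triplePow m v`, on which an
invariant functional is a function of three vectors of the plane. `SL(2)` acts transitively on the
triples whose three brackets (determinants of pairs of vectors) are `1`, so that such a functional
is a multiple of the product of the brackets with exponents `d`, where `m` is the weight of `d`
(`invariant_eq_brackets`); conversely these products define the functionals `bracketForm d`. Hence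
the diagonal invariants of the dual of `V(m)` have dimension one if `m` is a weight and zero
otherwise. By Frobenius reciprocity the isotypic component of type `V(m)` in the invariant ring is
the image of `V(m)` under the matrix coefficients of `bracketForm d` (`component_eq_range`), and by
the self-duality of `V(k)` the weights form the tensor semigroup (`range_weight`).

*The direct sum.* Matrix coefficients of distinct modules are linearly independent
(`eq_zero_of_sum_trace`): on a suitable one-parameter subgroup of the torus the leading terms do not
cancel. The Clebsch–Gordan rule, in the form of an identity for `(u · g⁻¹ v) ^ k (u' · g⁻¹ v')`,
shows that polynomials of multidegree `m` are sums of matrix coefficients of the `V(n)` with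
`n ≤ m` (`degreePart_le`). An invariant function has invariant components, so that the invariant
polynomials of multidegree `m` lie in `Γ(m)` (`mem_map_Gam`).

*The product formula.* `Γ(ω(d))` consists of the polynomials of multidegree `d` in the homogeneous
coordinates (`map_Gam_weight`). These have multidegree `ω(d)` in the `gᵢ`, which gives one
inclusion. For the other one, the copy of `V(ω(d'))` is spanned by products of brackets, which are
polynomials of multidegree `d'` in the homogeneous coordinates, and `ω(d') ≤ ω(d)` allows raising
the multidegree to `d` by means of `det Aᵢ = 1` and `Aᵢ = adj (Aᵢ₊₁ Aᵢ₊₂)`. Polynomials of multidegrees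
`d` and `e` visibly multiply onto those of multidegree `d + e`.

*Sections.* A section vanishes if it vanishes on the dense orbit, and polynomials are sections.
Conversely, a section is pulled back along `A ↦ (Aᵢ₊₁ adj Aᵢ₊₂)ᵢ` to triples of `2 × 2` matrices.
The pullback is regular where none of the three products is zero. This set contains all triples of
invertible matrices and meets every component of `∏ det Aᵢ = 0`; therefore the pullback is given on
the triples of invertible matrices by a polynomial (`exists_polynomial_of_locally_quotient`, by the
Nullstellensatz and unique factorisation). This polynomial is homogeneous of degree `ω(d)`, so its
restriction to `G` lies in `Γ(ω(d))` (`map_sectionsX`).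
-/

open scoped LinearAlgebra.Projectivization
open scoped TensorProduct

noncomputable section

namespace TripleSL2

/-! ### Binary forms and powers of linear forms -/

/-- The exponent of the monomial `X₀ ^ a * X₁ ^ b`. -/
def expo (a b : ℕ) : Fin 2 →₀ ℕ := Finsupp.single 0 a + Finsupp.single 1 b

@[simp] theorem expo_zero (a b : ℕ) : expo a b 0 = a := by simp [expo]

@[simp] theorem expo_one (a b : ℕ) : expo a b 1 = b := by simp [expo]

theorem eq_expo (d : Fin 2 →₀ ℕ) : d = expo (d 0) (d 1) := by
  ext i; fin_cases i <;> simp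

/-- The monomial `X₀ ^ a * X₁ ^ (k - a)` as a binary form of degree `k`. -/
def monoForm (k : ℕ) (a : Fin (k + 1)) : BinForm k :=
  ⟨MvPolynomial.monomial (expo a (k - a)) 1, MvPolynomial.isHomogeneous_monomial _ (by
    have := a.2
    simp [expo, Finsupp.degree_eq_sum]
    omega)⟩

/-- The coefficients of a binary form of degree `k` are its coordinates in the basis of
monomials. -/
def formCoord (k : ℕ) : BinForm k ≃ₗ[ℂ] (Fin (k + 1) → ℂ) where
  toFun p a := p.1.coeff (expo a (k - a))
  map_add' p q := by ext; simp
  map_smul' c p := by ext; simp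
  invFun c := ∑ a, c a • monoForm k a
  left_inv p := by
    ext d
    have hp := (MvPolynomial.mem_homogeneousSubmodule _ _).1 p.2
    simp only [AddSubmonoidClass.coe_finsetSum, SetLike.val_smul, MvPolynomial.coeff_sum,
      MvPolynomial.coeff_smul, monoForm, MvPolynomial.coeff_monomial, smul_eq_mul]
    by_cases hd : d 0 + d 1 = k
    · rw [Finset.sum_eq_single ⟨d 0, by omega⟩]
      · have h : expo (d 0) (k - d 0) = d := by
          rw [← hd, Nat.add_sub_cancel_left, ← eq_expo]
        simp [h]
      · intro b _ hb
        rw [if_neg, mul_zero]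
        rintro rfl
        exact hb (by simp)
      · simp
    · rw [hp.coeff_eq_zero (by simpa [Finsupp.degree_eq_sum] using hd), Finset.sum_eq_zero]
      intro b _
      rw [if_neg, mul_zero]
      rintro rfl
      have := b.2
      simp at hd
      omega
  right_inv c := by
    ext a
    simp only [AddSubmonoidClass.coe_finsetSum, SetLike.val_smul, MvPolynomial.coeff_sum,
      MvPolynomial.coeff_smul, monoForm, MvPolynomial.coeff_monomial, smul_eq_mul]
    rw [Finset.sum_eq_single a]
    · simp
    · intro b _ hb
      rw [if_neg, mul_zero]
      intro h
      have := DFunLike.congr_fun h 0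
      simp at this
      exact hb (Fin.ext this)
    · simp

/-- The basis of monomials of the space of binary forms of degree `k`. -/
def formBasis (k : ℕ) : Module.Basis (Fin (k + 1)) ℂ (BinForm k) :=
  Module.Basis.ofEquivFun (formCoord k)

instance (k : ℕ) : Module.Finite ℂ (BinForm k) := Module.Finite.of_basis (formBasis k)

theorem formBasis_apply (k : ℕ) (a : Fin (k + 1)) : formBasis k a = monoForm k a := by
  simp [formBasis, Module.Basis.coe_ofEquivFun, formCoord, Pi.single_apply]

/-- The linear form `v₀ X₀ + v₁ X₁`. -/
def linForm (v : Fin 2 → ℂ) : MvPolynomial (Fin 2) ℂ := ∑ i, MvPolynomial.C (v i) * MvPolynomial.X i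

theorem linForm_isHomogeneous (v : Fin 2 → ℂ) : (linForm v).IsHomogeneous 1 :=
  MvPolynomial.IsHomogeneous.sum _ _ _ fun i _ => by
    simpa using (MvPolynomial.isHomogeneous_C (Fin 2) (v i)).mul
        (MvPolynomial.isHomogeneous_X ℂ i)

/-- The power `(v₀ X₀ + v₁ X₁) ^ k` as a binary form of degree `k`. -/
def powForm (k : ℕ) (v : Fin 2 → ℂ) : BinForm k :=
  ⟨linForm v ^ k, by simpa using (linForm_isHomogeneous v).pow k⟩

theorem subst_linForm (g : SL2) (v : Fin 2 → ℂ) : subst g (linForm v) = linForm (g.1.mulVec v) := by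
  simp [linForm, subst, MvPolynomial.algHom_C, Matrix.mulVec, dotProduct, Fin.sum_univ_two]
  ring

theorem simpleSL2_coe (k : ℕ) (g : SL2) (p : BinForm k) :
    ((simpleSL2 k g p : BinForm k) : MvPolynomial (Fin 2) ℂ) = subst g p.1 := rfl

theorem simpleSL2_powForm (k : ℕ) (g : SL2) (v : Fin 2 → ℂ) :
    simpleSL2 k g (powForm k v) = powForm k (g.1.mulVec v) := by
  ext1
  simp [simpleSL2_coe, powForm, subst_linForm]

theorem powForm_smul (k : ℕ) (t : ℂ) (v : Fin 2 → ℂ) : powForm k (t • v) = t ^ k • powForm k v := by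
  ext1
  have : linForm (t • v) = MvPolynomial.C t * linForm v := by
    simp [linForm, Fin.sum_univ_two]; ring
  simp [powForm, this, mul_pow, MvPolynomial.smul_eq_C_mul]

theorem powForm_eq_sum (k : ℕ) (v : Fin 2 → ℂ) :
    powForm k v =
      ∑ a : Fin (k + 1), (k.choose a * v 0 ^ (a : ℕ) * v 1 ^ (k - a)) • monoForm k a := by
  ext1
  simp only [powForm, linForm, Fin.sum_univ_two, add_pow, AddSubmonoidClass.coe_finsetSum,
    SetLike.val_smul, monoForm]
  rw [Finset.sum_range]
  refine Finset.sum_congr rfl fun a _ => ?_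
  rw [MvPolynomial.smul_monomial, MvPolynomial.monomial_eq, expo,
    Finsupp.prod_add_index' (by simp) (by intros; ring)]
  simp
  ring

/-- If a polynomial in `s` with coefficients in a module takes values in a subspace at all
scalars `s`, then its coefficients lie in that subspace. -/
theorem coeff_mem_of_forall_sum_mem {M : Type*} [AddCommGroup M] [Module ℂ M] (K : Submodule ℂ M)
    {n : ℕ} (w : Fin n → M) (h : ∀ s : ℂ, ∑ j : Fin n, s ^ (j : ℕ) • w j ∈ K) (j : Fin n) :
    w j ∈ K := by
  by_contra hj
  obtain ⟨f, hf, hK⟩ := Submodule.exists_le_ker_of_notMem hj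
  have hP : (∑ j : Fin n, Polynomial.C (f (w j)) * Polynomial.X ^ (j : ℕ)) = 0 := by
    refine Polynomial.funext fun s => ?_
    have := hK (h s)
    simp only [LinearMap.mem_ker, map_sum, map_smul, smul_eq_mul] at this
    rw [Polynomial.eval_finsetSum, Polynomial.eval_zero, ← this]
    exact Finset.sum_congr rfl fun i _ => by
      rw [Polynomial.eval_mul, Polynomial.eval_C, Polynomial.eval_pow, Polynomial.eval_X, mul_comm]
  apply hf
  have := congrArg (fun p => p.coeff (j : ℕ)) hP
  simp only [Polynomial.finsetSum_coeff, Polynomial.coeff_C_mul, Polynomial.coeff_X_pow,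
    Polynomial.coeff_zero] at this
  rw [Finset.sum_eq_single j] at this
  · simpa using this
  · intro b _ hb
    rw [if_neg (fun e => hb (Fin.ext e.symm)), mul_zero]
  · simp

/-- The binary forms of degree `k` are spanned by the powers of the linear forms `s X₀ + X₁`. -/
theorem span_powForm (k : ℕ) :
    Submodule.span ℂ (Set.range fun s : ℂ => powForm k ![s, 1]) = ⊤ := by
  rw [eq_top_iff, ← (formBasis k).span_eq, Submodule.span_le]
  rintro _ ⟨a, rfl⟩
  rw [formBasis_apply]
  have := coeff_mem_of_forall_sum_mem
    (Submodule.span ℂ (Set.range fun s : ℂ => powForm k ![s, 1]))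
    (fun a : Fin (k + 1) => (k.choose a : ℂ) • monoForm k a) (fun s => by
      have := Submodule.subset_span (R := ℂ)
        (Set.mem_range_self (f := fun s : ℂ => powForm k ![s, 1]) s)
      rw [powForm_eq_sum k ![s, 1]] at this
      simpa only [SetLike.mem_coe, smul_smul, Matrix.cons_val_zero, Matrix.cons_val_one, one_pow,
        mul_one, mul_comm] using this) a
  rwa [SetLike.mem_coe, ← Submodule.smul_mem_iff _ (s := (k.choose a : ℂ))]
  exact_mod_cast (Nat.choose_pos (Nat.lt_succ_iff.1 a.2)).ne'

/-- Linear maps on binary forms agree if they agree on the powers of linear forms. -/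
theorem formHom_ext {k : ℕ} {M : Type*} [AddCommMonoid M] [Module ℂ M] {f g : BinForm k →ₗ[ℂ] M}
    (h : ∀ v, v ≠ 0 → f (powForm k v) = g (powForm k v)) : f = g := by
  refine LinearMap.ext_on_range (span_powForm k) fun s => h _ fun e => ?_
  simpa using congrFun e 1

/-- Evaluation of binary forms at a vector. -/
def evalForm (k : ℕ) (w : Fin 2 → ℂ) : Module.Dual ℂ (BinForm k) :=
  (MvPolynomial.aeval w).toLinearMap ∘ₗ Submodule.subtype _

theorem evalForm_apply (k : ℕ) (w : Fin 2 → ℂ) (p : BinForm k) :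
    evalForm k w p = MvPolynomial.eval w p.1 := by
  simp [evalForm, MvPolynomial.aeval_eq_eval]

theorem evalForm_powForm (k : ℕ) (w v : Fin 2 → ℂ) :
    evalForm k w (powForm k v) = (w ⬝ᵥ v) ^ k := by
  simp [evalForm_apply, powForm, linForm, dotProduct, Fin.sum_univ_two, mul_comm]

/-- A binary form that vanishes at all nonzero vectors is zero. -/
theorem eq_zero_of_evalForm {k : ℕ} {p : BinForm k} (h : ∀ w, w ≠ 0 → evalForm k w p = 0) :
    p = 0 := by
  ext1
  have : p.1 * MvPolynomial.X 0 = 0 := by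
    refine MvPolynomial.funext fun w => ?_
    by_cases hw : w = 0
    · simp [hw]
    · have := h w hw
      rw [evalForm_apply] at this
      simp [this]
  simpa using this

/-- Linear functionals on binary forms are combinations of evaluations. -/
theorem span_evalForm (k : ℕ) :
    Submodule.span ℂ {f | ∃ w, w ≠ 0 ∧ f = evalForm k w} = ⊤ := by
  refine Submodule.span_eq_top_of_ne_zero fun p hp => ?_
  by_contra! H
  exact hp (eq_zero_of_evalForm fun w hw => H _ ⟨w, hw, rfl⟩)

/-- Translating a form amounts to transposing the translation at the point of evaluation. -/
theorem evalForm_simpleSL2 (k : ℕ) (w : Fin 2 → ℂ) (g : SL2) (p : BinForm k) :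
    evalForm k w (simpleSL2 k g p) = evalForm k (Matrix.vecMul w g.1) p := by
  have : evalForm k w ∘ₗ simpleSL2 k g = evalForm k (Matrix.vecMul w g.1) :=
    formHom_ext fun v _ => by
      rw [LinearMap.comp_apply, simpleSL2_powForm, evalForm_powForm, evalForm_powForm,
        Matrix.dotProduct_mulVec]
  exact LinearMap.congr_fun this p

/-! ### Pure powers in the simple modules of the triple product -/

/-- The space underlying the simple module `V(m)`. -/
abbrev TripleForm (m : Fin 3 → ℕ) : Type := BinForm (m 0) ⊗[ℂ] (BinForm (m 1) ⊗[ℂ] BinForm (m 2))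

/-- The tensor product of the powers of the three linear forms given by `v`. -/
def triplePow (m : Fin 3 → ℕ) (v : Fin 3 → Fin 2 → ℂ) : TripleForm m :=
  powForm (m 0) (v 0) ⊗ₜ (powForm (m 1) (v 1) ⊗ₜ powForm (m 2) (v 2))

theorem simpleG_tmul (m : Fin 3 → ℕ) (g : G) (p : BinForm (m 0)) (q : BinForm (m 1))
    (r : BinForm (m 2)) : simpleG m g (p ⊗ₜ (q ⊗ₜ r)) =
      simpleSL2 (m 0) (g 0) p ⊗ₜ (simpleSL2 (m 1) (g 1) q ⊗ₜ simpleSL2 (m 2) (g 2) r) := rfl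

theorem simpleG_triplePow (m : Fin 3 → ℕ) (g : G) (v : Fin 3 → Fin 2 → ℂ) :
    simpleG m g (triplePow m v) = triplePow m fun i => (g i).1.mulVec (v i) := by
  simp [triplePow, simpleG_tmul, simpleSL2_powForm]

theorem triplePow_smul (m : Fin 3 → ℕ) (t : Fin 3 → ℂ) (v : Fin 3 → Fin 2 → ℂ) :
    triplePow m (fun i => t i • v i) = (∏ i, t i ^ m i) • triplePow m v := by
  simp only [triplePow, powForm_smul, Fin.prod_univ_three, ← TensorProduct.smul_tmul',
    TensorProduct.tmul_smul, smul_smul]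
  ring_nf

/-- Linear maps on `V(m)` agree if they agree on the pure powers of triples of nonzero vectors. -/
theorem tripleHom_ext {m : Fin 3 → ℕ} {M : Type*} [AddCommMonoid M] [Module ℂ M]
    {f g : TripleForm m →ₗ[ℂ] M}
    (h : ∀ v, (∀ i, v i ≠ 0) → f (triplePow m v) = g (triplePow m v)) : f = g := by
  refine TensorProduct.ext (formHom_ext fun u hu => TensorProduct.ext (formHom_ext fun v hv =>
    formHom_ext fun w hw => ?_))
  exact h ![u, v, w] fun i => by fin_cases i <;> assumption

/-- Evaluation of the elements of `V(m)`, viewed as functions of three vectors, at `w`. -/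
def evalTripleForm (m : Fin 3 → ℕ) (w : Fin 3 → Fin 2 → ℂ) : Module.Dual ℂ (TripleForm m) :=
  TensorProduct.dualDistrib ℂ _ _ (evalForm (m 0) (w 0) ⊗ₜ
    TensorProduct.dualDistrib ℂ _ _ (evalForm (m 1) (w 1) ⊗ₜ evalForm (m 2) (w 2)))

/-- The pairing of a linear functional on `V(m)` with pure powers is a polynomial in the
coordinates of the vectors. -/
theorem exists_polynomial_triplePow {m : Fin 3 → ℕ} (η : Module.Dual ℂ (TripleForm m)) :
    ∃ P : MvPolynomial (Fin 3 × Fin 2) ℂ, ∀ v : Fin 3 → Fin 2 → ℂ,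
      η (triplePow m v) = MvPolynomial.eval (fun x => v x.1 x.2) P := by
  let c (i : Fin 3) (a : Fin (m i + 1)) : MvPolynomial (Fin 3 × Fin 2) ℂ :=
    MvPolynomial.C ((m i).choose a : ℂ) * MvPolynomial.X (i, 0) ^ (a : ℕ) *
      MvPolynomial.X (i, 1) ^ (m i - a)
  refine ⟨∑ d, c 2 d * ∑ b, c 1 b * ∑ a, c 0 a * MvPolynomial.C
    (η (monoForm _ a ⊗ₜ (monoForm _ b ⊗ₜ monoForm _ d))), fun v => ?_⟩
  simp only [triplePow, powForm_eq_sum, TensorProduct.sum_tmul, TensorProduct.tmul_sum,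
    ← TensorProduct.smul_tmul', TensorProduct.tmul_smul, map_sum, map_smul, smul_eq_mul, c]
  simp only [map_sum, map_mul, map_pow, MvPolynomial.eval_C, MvPolynomial.eval_X]

theorem weight_injective : Function.Injective weight := by
  intro d e h
  have h0 := congrFun h 0
  have h1 := congrFun h 1
  have h2 := congrFun h 2
  simp [weight] at h0 h1 h2
  funext i
  fin_cases i <;> simp <;> omega

/-! ### Invariants of three vectors under `SL(2)` -/

/-- The bracket of two vectors, that is, the determinant of the matrix they form. -/
def bracket (v w : Fin 2 → ℂ) : ℂ := v 0 * w 1 - v 1 * w 0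

/-- The `i`-th bracket of a triple of vectors: that of the two others, in cyclic order. -/
def tripleBracket (v : Fin 3 → Fin 2 → ℂ) (i : Fin 3) : ℂ := bracket (v (i + 1)) (v (i + 2))

theorem bracket_mulVec (g : Mat) (v w : Fin 2 → ℂ) :
    bracket (g.mulVec v) (g.mulVec w) = g.det * bracket v w := by
  simp [bracket, Matrix.mulVec, dotProduct, Fin.sum_univ_two, Matrix.det_fin_two]
  ring

/-- A triple of vectors whose three brackets are equal to `1`. -/
def stdTriple : Fin 3 → Fin 2 → ℂ := ![![1, 0], ![0, 1], ![-1, -1]]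

/-- `SL(2)` acts transitively on the triples of vectors with all brackets equal to `1`. -/
theorem exists_mulVec_stdTriple {v : Fin 3 → Fin 2 → ℂ} (hv : ∀ i, tripleBracket v i = 1) :
    ∃ h : SL2, ∀ i, v i = h.1.mulVec (stdTriple i) := by
  have h0 := hv 0
  have h1 := hv 1
  have h2 := hv 2
  simp only [tripleBracket, bracket, Fin.isValue, zero_add, Fin.reduceAdd] at h0 h1 h2
  refine ⟨⟨!![v 0 0, v 1 0; v 0 1, v 1 1], by
    simp [Matrix.det_fin_two]; linear_combination h2⟩, fun i => ?_⟩
  -- The third vector is minus the sum of the two others, by the relation between three vectors of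
  -- the plane.
  have e0 : v 2 0 = - v 0 0 - v 1 0 := by
    linear_combination (-v 0 0) * h0 - v 1 0 * h1 - v 2 0 * h2
  have e1 : v 2 1 = - v 0 1 - v 1 1 := by
    linear_combination (-v 0 1) * h0 - v 1 1 * h1 - v 2 1 * h2
  ext a
  fin_cases i <;> fin_cases a <;>
    simp [stdTriple, Matrix.mulVec, dotProduct, Fin.sum_univ_two, e0, e1] <;> ring

/-- Nonzero scalars can be written as `βᵢ = tᵢ₊₁ tᵢ₊₂`. Dividing the vectors of a triple with
brackets `βᵢ` by the `tᵢ` makes all the brackets equal to `1`. -/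
theorem exists_scaling {β : Fin 3 → ℂ} (hβ : ∀ i, β i ≠ 0) :
    ∃ t : Fin 3 → ℂ, (∀ i, t i ≠ 0) ∧ ∀ i, t (i + 1) * t (i + 2) = β i := by
  have h0 := hβ 0
  have h1 := hβ 1
  have h2 := hβ 2
  obtain ⟨z, hz⟩ := IsAlgClosed.exists_pow_nat_eq (β 1 * β 2 / β 0) (n := 2) (by norm_num)
  have hz0 : z ≠ 0 := by
    rintro rfl
    have : β 1 * β 2 / β 0 ≠ 0 := by positivity
    exact this (by simpa using hz.symm)
  refine ⟨![z, β 2 / z, β 1 / z], fun i => ?_, fun i => ?_⟩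
  · fin_cases i <;> simp [hz0, h1, h2]
  · fin_cases i <;> simp
    · field_simp
      rw [hz]
      field_simp
    · field_simp
    · field_simp

/-- An invariant linear functional on `V(m)` is determined on pure powers of triples with nonzero
brackets by its value at one triple. -/
theorem invariant_eq_smul {m : Fin 3 → ℕ} {η : Module.Dual ℂ (TripleForm m)}
    (hη : ∀ (h : SL2) x, η (simpleG m (fun _ => h) x) = η x) {v : Fin 3 → Fin 2 → ℂ}
    {t : Fin 3 → ℂ} (ht0 : ∀ i, t i ≠ 0) (ht : ∀ i, t (i + 1) * t (i + 2) = tripleBracket v i) :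
    η (triplePow m v) = (∏ i, t i ^ m i) * η (triplePow m stdTriple) := by
  obtain ⟨h, hh⟩ := exists_mulVec_stdTriple (v := fun i => (t i)⁻¹ • v i) fun i => by
    have h1 := ht0 (i + 1)
    have h2 := ht0 (i + 2)
    have := ht i
    simp only [tripleBracket, bracket, Pi.smul_apply, smul_eq_mul] at this ⊢
    field_simp
    linear_combination -this
  have hv : v = fun i => t i • (h.1.mulVec (stdTriple i)) := by
    funext i
    rw [← hh i, smul_smul, mul_inv_cancel₀ (ht0 i), one_smul]
  rw [hv, triplePow_smul, map_smul, smul_eq_mul, ← hη h (triplePow m stdTriple), simpleG_triplePow]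

/-- Polynomial identities in three vectors may be checked on triples with nonzero brackets. -/
theorem funext_of_bracket_ne_zero {P Q : MvPolynomial (Fin 3 × Fin 2) ℂ}
    (h : ∀ v : Fin 3 → Fin 2 → ℂ, (∀ i, tripleBracket v i ≠ 0) →
      MvPolynomial.eval (fun x => v x.1 x.2) P = MvPolynomial.eval (fun x => v x.1 x.2) Q) :
    P = Q := by
  let D : MvPolynomial (Fin 3 × Fin 2) ℂ := ∏ i : Fin 3,
    (MvPolynomial.X (i + 1, 0) * MvPolynomial.X (i + 2, 1) -
      MvPolynomial.X (i + 1, 1) * MvPolynomial.X (i + 2, 0))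
  have hD (v : Fin 3 → Fin 2 → ℂ) :
      MvPolynomial.eval (fun x => v x.1 x.2) D = ∏ i, tripleBracket v i := by
    simp [D, tripleBracket, bracket]
  have hD0 : D ≠ 0 := by
    intro h0
    have := hD stdTriple
    rw [h0] at this
    simp [Fin.prod_univ_three, tripleBracket, bracket, stdTriple] at this
  refine mul_right_cancel₀ hD0 (MvPolynomial.funext fun x => ?_)
  have hx := hD fun i j => x (i, j)
  by_cases H : ∀ i, tripleBracket (fun i j => x (i, j)) i ≠ 0
  · have := h _ H
    simp only [Prod.mk.eta] at this
    simp only [map_mul, this]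
  · push Not at H
    obtain ⟨i, hi⟩ := H
    rw [Finset.prod_eq_zero (Finset.mem_univ i) hi] at hx
    simp only [Prod.mk.eta] at hx
    simp only [map_mul, hx, mul_zero]

/-- If `q ^ 2 * s ^ a = c ^ 2 * s ^ b` for a polynomial `q` and all `s ≠ 0`, where `c ≠ 0`, then
`b - a` is even and nonnegative. -/
theorem exists_add_two_mul_eq {q : Polynomial ℂ} {c : ℂ} (hc : c ≠ 0) {a b : ℕ}
    (h : ∀ s : ℂ, s ≠ 0 → q.eval s ^ 2 * s ^ a = c ^ 2 * s ^ b) : ∃ d, a + 2 * d = b := by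
  have hq : q ^ 2 * Polynomial.X ^ a = Polynomial.C (c ^ 2) * Polynomial.X ^ b := by
    refine mul_right_cancel₀ Polynomial.X_ne_zero (Polynomial.funext fun s => ?_)
    by_cases hs : s = 0
    · simp [hs]
    · have := h s hs
      simp only [Polynomial.eval_mul, Polynomial.eval_pow, Polynomial.eval_X, Polynomial.eval_C,
        this]
  have hq0 : q ≠ 0 := by
    rintro rfl
    have := h 1 one_ne_zero
    simp at this
    exact hc (by simpa using this.symm)
  have := congrArg Polynomial.natDegree hq
  rw [Polynomial.natDegree_mul (pow_ne_zero _ hq0) (pow_ne_zero _ Polynomial.X_ne_zero),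
    Polynomial.natDegree_C_mul (pow_ne_zero _ hc)] at this
  simp at this
  exact ⟨q.natDegree, by omega⟩

/-- A triple of vectors whose `i`-th bracket is `s`, and whose other brackets are `1`. -/
def bracketCurve (i : Fin 3) (s : ℂ) (j : Fin 3) : Fin 2 → ℂ :=
  (![![1, 0], ![0, 1], ![-s, -1]] : Fin 3 → Fin 2 → ℂ) (j - i)

theorem tripleBracket_bracketCurve (i : Fin 3) (s : ℂ) :
    tripleBracket (bracketCurve i s) = fun j => if j = i then s else 1 := by
  funext j
  fin_cases i <;> fin_cases j <;> simp [tripleBracket, bracket, bracketCurve]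

theorem bracketCurve_polynomial {m : Fin 3 → ℕ} (η : Module.Dual ℂ (TripleForm m)) (i : Fin 3) :
    ∃ q : Polynomial ℂ, ∀ s, η (triplePow m (bracketCurve i s)) = q.eval s := by
  obtain ⟨P, hP⟩ := exists_polynomial_triplePow η
  refine ⟨MvPolynomial.aeval (fun x : Fin 3 × Fin 2 => (![![1, 0], ![0, 1],
    ![-Polynomial.X, -1]] : Fin 3 → Fin 2 → Polynomial ℂ) (x.1 - i) x.2) P, fun s => ?_⟩
  rw [hP, ← Polynomial.coe_evalRingHom, MvPolynomial.aeval_def, MvPolynomial.hom_eval₂]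
  have : (Polynomial.evalRingHom s).comp (algebraMap ℂ (Polynomial ℂ)) = RingHom.id ℂ := by
    ext; simp
  rw [this, MvPolynomial.eval, MvPolynomial.coe_eval₂Hom]
  congr 1
  funext ⟨j, a⟩
  simp only [bracketCurve]
  generalize j - i = l
  fin_cases l <;> fin_cases a <;> simp

/-- The first fundamental theorem for three vectors: a nonzero invariant functional on `V(m)`
exists only if `m` is the weight of some `d`, and on pure powers it is then a multiple of the
product of the brackets with exponents `d`. -/
theorem invariant_eq_brackets {m : Fin 3 → ℕ} {η : Module.Dual ℂ (TripleForm m)} (hη0 : η ≠ 0)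
    (hη : ∀ (h : SL2) x, η (simpleG m (fun _ => h) x) = η x) :
    ∃ d, m = weight d ∧ ∃ c : ℂ,
      ∀ v, η (triplePow m v) = c * ∏ i, tripleBracket v i ^ d i := by
  obtain ⟨P, hP⟩ := exists_polynomial_triplePow η
  set c := η (triplePow m stdTriple) with hc
  have hc0 : c ≠ 0 := by
    intro h0
    have : P = 0 := funext_of_bracket_ne_zero fun v hv => by
      obtain ⟨t, ht0, ht⟩ := exists_scaling hv
      rw [← hP, invariant_eq_smul hη ht0 ht, ← hc, h0]
      simp
    refine hη0 (tripleHom_ext fun v _ => ?_)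
    rw [hP, this]
    simp
  -- Along `bracketCurve i` the value of `η` is a polynomial in the bracket `s`, whose square is
  -- known from the scaling behaviour of `η`; the degrees must match.
  have key (i : Fin 3) : ∃ d, m i + 2 * d = m (i + 1) + m (i + 2) := by
    obtain ⟨q, hq⟩ := bracketCurve_polynomial η i
    refine exists_add_two_mul_eq (q := q) hc0 fun s hs => ?_
    obtain ⟨t, ht0, ht⟩ := exists_scaling (β := tripleBracket (bracketCurve i s)) fun j => by
      rw [tripleBracket_bracketCurve]
      dsimp only
      split_ifs <;> simp [hs]
    rw [← hq, invariant_eq_smul hη ht0 ht, ← hc]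
    rw [tripleBracket_bracketCurve] at ht
    have e0 := ht i
    have e1 := ht (i + 1)
    have e2 := ht (i + 2)
    have a0 := ht0 i
    have i1 : i + 1 + 1 = i + 2 := by rw [add_assoc]; rfl
    have i2 : i + 1 + 2 = i := by rw [add_assoc]; exact add_zero i
    have i3 : i + 2 + 1 = i := by rw [add_assoc]; exact add_zero i
    have i4 : i + 2 + 2 = i + 1 := by rw [add_assoc]; rfl
    have n1 : i + 1 ≠ i := by simp
    have n2 : i + 2 ≠ i := by simp
    dsimp only at e0 e1 e2
    rw [if_pos rfl] at e0
    rw [if_neg n1, i1, i2] at e1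
    rw [if_neg n2, i3, i4] at e2
    have hprod : ∏ j, t j ^ m j = t i ^ m i * t (i + 1) ^ m (i + 1) * t (i + 2) ^ m (i + 2) := by
      rw [Fin.prod_univ_three]
      fin_cases i <;> simp <;> ring
    have f1 : t (i + 1) = (t i)⁻¹ := by field_simp; linear_combination e2
    have f2 : t (i + 2) = (t i)⁻¹ := by field_simp; linear_combination e1
    rw [hprod, ← e0, f1, f2]
    have hu : (t i * (t i)⁻¹) ^ (2 * m i) = 1 := by rw [mul_inv_cancel₀ a0, one_pow]
    generalize (t i)⁻¹ = u at hu
    linear_combination (c ^ 2 * u ^ (2 * m (i + 1) + 2 * m (i + 2))) * hu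
  choose d hd using key
  have hm : m = weight d := by
    have h0 := hd 0
    have h1 := hd 1
    have h2 := hd 2
    simp at h0 h1 h2
    funext i
    fin_cases i <;> simp [weight] <;> omega
  refine ⟨d, hm, c, fun v => ?_⟩
  let Q : MvPolynomial (Fin 3 × Fin 2) ℂ := MvPolynomial.C c * ∏ i : Fin 3,
    (MvPolynomial.X (i + 1, 0) * MvPolynomial.X (i + 2, 1) -
      MvPolynomial.X (i + 1, 1) * MvPolynomial.X (i + 2, 0)) ^ d i
  have hQ (v : Fin 3 → Fin 2 → ℂ) : MvPolynomial.eval (fun x => v x.1 x.2) Q =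
      c * ∏ i, tripleBracket v i ^ d i := by
    simp [Q, tripleBracket, bracket]
  rw [hP, ← hQ]
  congr 1
  refine funext_of_bracket_ne_zero fun v hv => ?_
  obtain ⟨t, ht0, ht⟩ := exists_scaling hv
  rw [hQ, ← hP, invariant_eq_smul hη ht0 ht, ← hc, mul_comm]
  congr 1
  simp only [← ht, Fin.prod_univ_three, hm, weight]
  simp
  ring

/-- The functions of three vectors that arise from linear functionals on `V(m)`: the forms of
multidegree `m`. -/
def formFun (m : Fin 3 → ℕ) : Submodule ℂ ((Fin 3 → Fin 2 → ℂ) → ℂ) :=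
  LinearMap.range (LinearMap.pi fun v => Module.Dual.eval ℂ (TripleForm m) (triplePow m v))

theorem mem_formFun {m : Fin 3 → ℕ} {f : (Fin 3 → Fin 2 → ℂ) → ℂ} :
    f ∈ formFun m ↔ ∃ η : Module.Dual ℂ (TripleForm m), ∀ v, η (triplePow m v) = f v := by
  simp [formFun, funext_iff]

/-- The coordinate functionals, normalised to take pure powers to monomials. -/
theorem exists_dual_monomial (k : ℕ) (a : Fin (k + 1)) :
    ∃ f : Module.Dual ℂ (BinForm k), ∀ v, f (powForm k v) = v 0 ^ (a : ℕ) * v 1 ^ (k - a) := by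
  have hk : (k.choose a : ℂ) ≠ 0 := by exact_mod_cast (Nat.choose_pos (Nat.lt_succ_iff.1 a.2)).ne'
  refine ⟨(k.choose a : ℂ)⁻¹ • (formBasis k).coord a, fun v => ?_⟩
  simp only [powForm_eq_sum, ← formBasis_apply, map_sum, map_smul, LinearMap.smul_apply,
    Module.Basis.coord_apply, Module.Basis.repr_self]
  rw [Finset.sum_eq_single a]
  · simp
    field_simp
  · intro b _ hb
    simp [hb]
  · simp

/-- The monomial functions of multidegree `m` in three vectors. -/
def monoFun (m : Fin 3 → ℕ) : Set ((Fin 3 → Fin 2 → ℂ) → ℂ) :=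
  {f | ∃ a b : Fin 3 → ℕ, a + b = m ∧ f = fun v => ∏ i, v i 0 ^ a i * v i 1 ^ b i}

theorem span_monoFun_le (m : Fin 3 → ℕ) : Submodule.span ℂ (monoFun m) ≤ formFun m := by
  rw [Submodule.span_le]
  rintro _ ⟨a, b, rfl, rfl⟩
  rw [SetLike.mem_coe, mem_formFun]
  have h (i : Fin 3) := exists_dual_monomial ((a + b) i) ⟨a i, by simp⟩
  choose f hf using h
  refine ⟨TensorProduct.dualDistrib ℂ _ _ (f 0 ⊗ₜ
    TensorProduct.dualDistrib ℂ _ _ (f 1 ⊗ₜ f 2)), fun v => ?_⟩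
  have hf' (i : Fin 3) : f i (powForm ((a + b) i) (v i)) = v i 0 ^ a i * v i 1 ^ b i := by
    rw [hf]
    simp
  simp only [triplePow, TensorProduct.dualDistrib_apply, hf', Fin.prod_univ_three]
  ring

theorem span_monoFun_mul (m n : Fin 3 → ℕ) :
    Submodule.span ℂ (monoFun m) * Submodule.span ℂ (monoFun n) ≤
      Submodule.span ℂ (monoFun (m + n)) := by
  rw [Submodule.span_mul_span]
  refine Submodule.span_mono ?_
  rintro _ ⟨_, ⟨a, b, rfl, rfl⟩, _, ⟨a', b', rfl, rfl⟩, rfl⟩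
  refine ⟨a + a', b + b', by abel, ?_⟩
  funext v
  simp [pow_add, Fin.prod_univ_three]
  ring

theorem prod_bracket_mem (d : Fin 3 → ℕ) :
    (fun v => ∏ i, tripleBracket v i ^ d i) ∈ Submodule.span ℂ (monoFun (weight d)) := by
  have hb (i : Fin 3) : (fun v => tripleBracket v i) ∈
      Submodule.span ℂ (monoFun (weight (Pi.single i 1))) := by
    have : (fun v => tripleBracket v i) =
        (fun v : Fin 3 → Fin 2 → ℂ => v (i + 1) 0 * v (i + 2) 1) -
          fun v => v (i + 1) 1 * v (i + 2) 0 := rfl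
    rw [this]
    refine sub_mem (Submodule.subset_span ⟨Pi.single (i + 1) 1, Pi.single (i + 2) 1, ?_, ?_⟩)
      (Submodule.subset_span ⟨Pi.single (i + 2) 1, Pi.single (i + 1) 1, ?_, ?_⟩)
    · funext j; fin_cases i <;> fin_cases j <;> simp [weight]
    · funext v; fin_cases i <;> simp [Fin.prod_univ_three, mul_comm]
    · funext j; fin_cases i <;> fin_cases j <;> simp [weight]
    · funext v; fin_cases i <;> simp [Fin.prod_univ_three, mul_comm]
  have hp (i : Fin 3) (k : ℕ) : (fun v => tripleBracket v i ^ k) ∈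
      Submodule.span ℂ (monoFun (k • weight (Pi.single i 1))) := by
    induction k with
    | zero =>
      refine Submodule.subset_span ⟨0, 0, by simp, by simp⟩
    | succ k ih =>
      rw [add_smul, one_smul]
      exact span_monoFun_mul _ _ (Submodule.mul_mem_mul ih (hb i))
  have := span_monoFun_mul _ _ (Submodule.mul_mem_mul
    (span_monoFun_mul _ _ (Submodule.mul_mem_mul (hp 0 (d 0)) (hp 1 (d 1)))) (hp 2 (d 2)))
  have hd : d 0 • weight (Pi.single 0 1) + d 1 • weight (Pi.single 1 1) +
      d 2 • weight (Pi.single 2 1) = weight d := by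
    funext j
    fin_cases j <;> simp [weight, add_comm]
  rw [hd] at this
  convert this using 1
  funext v
  simp [Fin.prod_univ_three]

/-- The invariant functional on `V(m)`, `m` the weight of `d`, given on pure powers by the
product of the brackets with exponents `d`. -/
theorem exists_bracketForm (d : Fin 3 → ℕ) : ∃ η : Module.Dual ℂ (TripleForm (weight d)),
    ∀ v, η (triplePow (weight d) v) = ∏ i, tripleBracket v i ^ d i :=
  mem_formFun.1 (span_monoFun_le _ (prod_bracket_mem d))

/-- The invariant functional on `V(m)`, `m` the weight of `d`, given on pure powers by the
product of the brackets with exponents `d`. -/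
def bracketForm (d : Fin 3 → ℕ) : Module.Dual ℂ (TripleForm (weight d)) :=
  (exists_bracketForm d).choose

theorem bracketForm_triplePow (d : Fin 3 → ℕ) (v : Fin 3 → Fin 2 → ℂ) :
    bracketForm d (triplePow (weight d) v) = ∏ i, tripleBracket v i ^ d i :=
  (exists_bracketForm d).choose_spec v

theorem bracketForm_simpleG (d : Fin 3 → ℕ) (h : SL2) (x : TripleForm (weight d)) :
    bracketForm d (simpleG (weight d) (fun _ => h) x) = bracketForm d x := by
  have : bracketForm d ∘ₗ simpleG (weight d) (fun _ => h) = bracketForm d :=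
    tripleHom_ext fun v _ => by
      simp only [LinearMap.comp_apply, simpleG_triplePow, bracketForm_triplePow, tripleBracket,
        bracket_mulVec, h.2, one_mul]
  exact LinearMap.congr_fun this x

theorem bracketForm_ne_zero (d : Fin 3 → ℕ) : bracketForm d ≠ 0 := by
  intro h
  have := bracketForm_triplePow d stdTriple
  rw [h] at this
  simp [Fin.prod_univ_three, tripleBracket, bracket, stdTriple] at this

/-- Invariant functionals on `V(m)` are unique up to scalars. -/
theorem invariant_eq_smul_bracketForm {d : Fin 3 → ℕ} {η : Module.Dual ℂ (TripleForm (weight d))}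
    (hη : ∀ (h : SL2) x, η (simpleG (weight d) (fun _ => h) x) = η x) :
    ∃ c : ℂ, η = c • bracketForm d := by
  by_cases h0 : η = 0
  · exact ⟨0, by simp [h0]⟩
  obtain ⟨e, he, c, hc⟩ := invariant_eq_brackets h0 hη
  obtain rfl : d = e := weight_injective he
  exact ⟨c, tripleHom_ext fun v _ => by simp [hc, bracketForm_triplePow]⟩

/-! ### Linear independence of matrix coefficients -/

/-- The basis of tensor products of monomials of the module `V(m)`. -/
def tripleBasis (m : Fin 3 → ℕ) :
    Module.Basis (Fin (m 0 + 1) × Fin (m 1 + 1) × Fin (m 2 + 1)) ℂ (TripleForm m) :=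
  (formBasis (m 0)).tensorProduct ((formBasis (m 1)).tensorProduct (formBasis (m 2)))

theorem tripleBasis_repr (m : Fin 3 → ℕ) (x : TripleForm m)
    (a : Fin (m 0 + 1) × Fin (m 1 + 1) × Fin (m 2 + 1)) :
    (tripleBasis m).repr x a =
      TensorProduct.dualDistrib ℂ _ _ ((formBasis (m 0)).coord a.1 ⊗ₜ
        TensorProduct.dualDistrib ℂ _ _
          ((formBasis (m 1)).coord a.2.1 ⊗ₜ (formBasis (m 2)).coord a.2.2)) x := by
  rw [← Module.Basis.coord_apply]
  refine LinearMap.congr_fun (tripleHom_ext fun v _ => ?_) x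
  obtain ⟨a, b, c⟩ := a
  simp [tripleBasis, triplePow, Module.Basis.tensorProduct_repr_tmul_apply]
  ring

/-- An element of `V(m)` whose values at all triples of nonzero vectors vanish is zero. -/
theorem eq_zero_of_evalTripleForm {m : Fin 3 → ℕ} {x : TripleForm m}
    (h : ∀ w, (∀ i, w i ≠ 0) → evalTripleForm m w x = 0) : x = 0 := by
  let Ψ := (Module.Dual.eval ℂ (TripleForm m) x) ∘ₗ TensorProduct.dualDistrib ℂ _ _ ∘ₗ
    (TensorProduct.dualDistrib ℂ (BinForm (m 1)) (BinForm (m 2))).lTensor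
      (Module.Dual ℂ (BinForm (m 0)))
  have hΨ : Ψ = 0 := by
    refine TensorProduct.ext (LinearMap.ext_on (span_evalForm _) ?_)
    rintro _ ⟨u, hu, rfl⟩
    refine TensorProduct.ext (LinearMap.ext_on (span_evalForm _) ?_)
    rintro _ ⟨v, hv, rfl⟩
    refine LinearMap.ext_on (span_evalForm _) ?_
    rintro _ ⟨w, hw, rfl⟩
    exact h ![u, v, w] fun i => by fin_cases i <;> assumption
  refine (tripleBasis m).ext_elem fun a => ?_
  rw [tripleBasis_repr]
  simpa [Ψ] using LinearMap.congr_fun hΨ ((formBasis (m 0)).coord a.1 ⊗ₜ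
    ((formBasis (m 1)).coord a.2.1 ⊗ₜ (formBasis (m 2)).coord a.2.2))

/-- The coordinate at the highest weight vector `X₀ ^ k` is the value at `(1, 0)`. -/
theorem coord_last_eq_evalForm (k : ℕ) :
    (formBasis k).coord (Fin.last k) = evalForm k ![1, 0] := by
  refine formHom_ext fun v _ => ?_
  rw [evalForm_powForm, powForm_eq_sum]
  simp only [← formBasis_apply, map_sum, map_smul, Module.Basis.coord_apply,
    Module.Basis.repr_self]
  rw [Finset.sum_eq_single (Fin.last k)]
  · simp [dotProduct, Fin.sum_univ_two]
  · intro b _ hb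
    simp [hb]
  · simp

theorem powForm_eq_formBasis_last (k : ℕ) : powForm k ![1, 0] = formBasis k (Fin.last k) := by
  rw [powForm_eq_sum, Finset.sum_eq_single (Fin.last k)]
  · simp [formBasis_apply]
  · intro b _ hb
    have : (b : ℕ) < k := Fin.val_lt_last hb
    simp [show k - (b : ℕ) ≠ 0 by omega]
  · simp

/-- The element `diag(t, t⁻¹)` of the maximal torus. -/
def torus (t : ℂˣ) : SL2 := ⟨!![(t : ℂ), 0; 0, ((t⁻¹ : ℂˣ) : ℂ)], by simp⟩

theorem subst_torus_X (t : ℂˣ) (j : Fin 2) : subst (torus t) (MvPolynomial.X j) =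
    MvPolynomial.C (![(t : ℂ), ((t⁻¹ : ℂˣ) : ℂ)] j) * MvPolynomial.X j := by
  fin_cases j <;> simp [subst, torus]

/-- The monomial `X₀ ^ a * X₁ ^ (k - a)` has weight `2 a - k`. The factor `t ^ k` keeps the
exponents nonnegative. -/
theorem simpleSL2_torus (k : ℕ) (t : ℂˣ) (a : Fin (k + 1)) :
    (t : ℂ) ^ k • simpleSL2 k (torus t) (formBasis k a) =
      (t : ℂ) ^ (2 * (a : ℕ)) • formBasis k a := by
  ext1
  have ha := Nat.lt_succ_iff.1 a.2
  have hmono : (formBasis k a).1 = MvPolynomial.X 0 ^ (a : ℕ) * MvPolynomial.X 1 ^ (k - a) := by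
    rw [formBasis_apply]
    change MvPolynomial.monomial (expo a (k - a)) 1 = _
    rw [MvPolynomial.monomial_eq, expo,
      Finsupp.prod_add_index' (by simp) (by intros; ring)]
    simp
  have ht : (t : ℂ) ^ k * ((t : ℂ) ^ (a : ℕ) * ((t⁻¹ : ℂˣ) : ℂ) ^ (k - a)) =
      (t : ℂ) ^ (2 * (a : ℕ)) := by
    have h1 : (t : ℂ) ^ (k - a) * ((t⁻¹ : ℂˣ) : ℂ) ^ (k - a) = 1 := by
      rw [← mul_pow, Units.mul_inv, one_pow]
    have h2 : (t : ℂ) ^ k = (t : ℂ) ^ (a : ℕ) * (t : ℂ) ^ (k - a) := by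
      rw [← pow_add, Nat.add_sub_cancel' ha]
    rw [h2]
    linear_combination ((t : ℂ) ^ (a : ℕ) * (t : ℂ) ^ (a : ℕ)) * h1
  simp only [SetLike.val_smul, simpleSL2_coe, hmono, map_mul, map_pow, subst_torus_X, ← ht,
    MvPolynomial.smul_eq_C_mul, Matrix.cons_val_zero, Matrix.cons_val_one]
  ring

theorem trace_eq_sum_repr {ι M : Type*} [Fintype ι] [AddCommMonoid M] [Module ℂ M]
    (b : Module.Basis ι ℂ M) (f : Module.End ℂ M) :
    LinearMap.trace ℂ M f = ∑ i, b.repr (f (b i)) i := by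
  classical
  rw [LinearMap.trace_eq_matrix_trace ℂ b, Matrix.trace]
  simp [LinearMap.toMatrix_apply]

/-- The weighted degree `n₀ + M n₁ + M² n₂`, which separates the `n` with all `nᵢ < M`. -/
def code (M : ℕ) (n : Fin 3 → ℕ) : ℕ := n 0 + M * (n 1 + M * n 2)

theorem code_injOn {M : ℕ} {m n : Fin 3 → ℕ} (hm : ∀ i, m i < M) (hn : ∀ i, n i < M)
    (h : code M m = code M n) : m = n := by
  have key {a b c d : ℕ} (ha : a < M) (hc : c < M) (h : a + M * b = c + M * d) :
      a = c ∧ b = d := by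
    have h1 : a = c := by
      have := congrArg (· % M) h
      simpa [Nat.add_mul_mod_self_left, Nat.mod_eq_of_lt ha, Nat.mod_eq_of_lt hc] using this
    refine ⟨h1, ?_⟩
    rw [h1] at h
    exact Nat.eq_of_mul_eq_mul_left (by omega) (Nat.add_left_cancel h)
  obtain ⟨h0, h'⟩ := key (hm 0) (hn 0) h
  obtain ⟨h1, h''⟩ := key (hm 1) (hn 1) h'
  funext i
  fin_cases i <;> simp [h0, h1, h'']

/-- The one-parameter subgroup of the maximal torus of `G` that acts on the highest weight vector
of `V(n)` by the power `code M n`. -/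
def tripleTorus (M : ℕ) (t : ℂˣ) : G := ![torus t, torus (t ^ M), torus (t ^ (M * M))]

theorem smul_tmul_tmul {A B C : Type*} [AddCommGroup A] [Module ℂ A] [AddCommGroup B] [Module ℂ B]
    [AddCommGroup C] [Module ℂ C] (r s t : ℂ) (a : A) (b : B) (c : C) :
    (r * (s * t)) • (a ⊗ₜ[ℂ] (b ⊗ₜ[ℂ] c)) = (r • a) ⊗ₜ[ℂ] ((s • b) ⊗ₜ[ℂ] (t • c)) := by
  simp only [← TensorProduct.smul_tmul', TensorProduct.tmul_smul, smul_smul]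
  ring_nf

theorem simpleG_tripleTorus (M : ℕ) (t : ℂˣ) (n : Fin 3 → ℕ)
    (a : Fin (n 0 + 1) × Fin (n 1 + 1) × Fin (n 2 + 1)) :
    (t : ℂ) ^ code M n • simpleG n (tripleTorus M t) (tripleBasis n a) =
      (t : ℂ) ^ (2 * code M ![a.1, a.2.1, a.2.2]) • tripleBasis n a := by
  obtain ⟨a, b, c⟩ := a
  have h0 := simpleSL2_torus (n 0) t a
  have h1 := simpleSL2_torus (n 1) (t ^ M) b
  have h2 := simpleSL2_torus (n 2) (t ^ (M * M)) c
  simp only [Units.val_pow_eq_pow_val, ← pow_mul] at h1 h2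
  have hb : tripleBasis n (a, b, c) =
    formBasis (n 0) a ⊗ₜ (formBasis (n 1) b ⊗ₜ formBasis (n 2) c) := by simp [tripleBasis]
  have e1 : code M n = n 0 + (M * n 1 + M * M * n 2) := by simp only [code]; ring
  have e2 : 2 * code M ![a, b, c] = 2 * (a : ℕ) + (M * (2 * b) + M * M * (2 * c)) := by
    simp [code]; ring
  rw [hb, simpleG_tmul, e1, e2, pow_add, pow_add, pow_add, pow_add, smul_tmul_tmul,
    smul_tmul_tmul, ← h0, ← h1, ← h2]
  rfl

/-- Nonzero vectors are the first columns of elements of `SL(2)`. -/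
theorem exists_SL2_col {v : Fin 2 → ℂ} (hv : v ≠ 0) :
    ∃ x : SL2, x.1.mulVec ![1, 0] = v := by
  by_cases h0 : v 0 = 0
  · have h1 : v 1 ≠ 0 := fun h1 => hv (by ext i; fin_cases i <;> simp [h0, h1])
    refine ⟨⟨!![v 0, -(v 1)⁻¹; v 1, 0], by simp [Matrix.det_fin_two, h1]⟩, ?_⟩
    ext i; fin_cases i <;> simp
  · refine ⟨⟨!![v 0, 0; v 1, (v 0)⁻¹], by simp [Matrix.det_fin_two, h0]⟩, ?_⟩
    ext i; fin_cases i <;> simp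

/-- Nonzero vectors are the first rows of elements of `SL(2)`. -/
theorem exists_SL2_row {w : Fin 2 → ℂ} (hw : w ≠ 0) :
    ∃ y : SL2, Matrix.vecMul ![1, 0] y.1 = w := by
  obtain ⟨x, hx⟩ := exists_SL2_col hw
  refine ⟨⟨x.1.transpose, by rw [Matrix.det_transpose]; exact x.2⟩, ?_⟩
  rw [Matrix.vecMul_transpose, hx]

theorem evalTripleForm_simpleG (m : Fin 3 → ℕ) (w : Fin 3 → Fin 2 → ℂ) (g : G) (x : TripleForm m) :
    evalTripleForm m w (simpleG m g x) =
      evalTripleForm m (fun i => Matrix.vecMul (w i) (g i).1) x := by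
  refine LinearMap.congr_fun (f := evalTripleForm m w ∘ₗ simpleG m g)
    (tripleHom_ext fun v _ => ?_) x
  simp only [LinearMap.comp_apply, triplePow, simpleG_tmul, evalTripleForm,
    TensorProduct.dualDistrib_apply, evalForm_simpleSL2]

/-- The diagonal entry of `ρ(y) T ρ(x)` at the highest weight vector is the value of `T` on a pure
power at a triple of vectors. This entry is the leading coefficient of the trace of `T ρ(x λ(t) y)`
as a function of the parameter `t` of the torus. -/
theorem repr_last_eq_evalTripleForm (m : Fin 3 → ℕ) (T : Module.End ℂ (TripleForm m)) (x y : G) :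
    (tripleBasis m).repr (simpleG m y (T (simpleG m x
      (tripleBasis m (Fin.last _, Fin.last _, Fin.last _))))) (Fin.last _, Fin.last _, Fin.last _) =
    evalTripleForm m (fun i => Matrix.vecMul ![1, 0] (y i).1)
      (T (triplePow m fun i => (x i).1.mulVec ![1, 0])) := by
  have h : tripleBasis m (Fin.last _, Fin.last _, Fin.last _) = triplePow m fun _ => ![1, 0] := by
    simp [tripleBasis, triplePow, powForm_eq_formBasis_last]
  rw [tripleBasis_repr, h, simpleG_triplePow]
  simp only [coord_last_eq_evalForm]
  exact evalTripleForm_simpleG m (fun _ => ![1, 0]) y _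

/-- The matrix coefficients of the modules `V(m)`, for distinct `m`, are linearly independent. In a
relation evaluated at `x λ(t) y`, the leading coefficient in `t` comes from the `m` of largest
weight alone; being zero for all `x` and `y`, it forces `T m` to vanish on all pure powers. -/
theorem eq_zero_of_sum_trace {S : Finset (Fin 3 → ℕ)} {T : ∀ m, Module.End ℂ (TripleForm m)}
    (h : ∀ g : G, ∑ m ∈ S, LinearMap.trace ℂ _ (T m ∘ₗ simpleG m g) = 0) :
    ∀ m ∈ S, T m = 0 := by
  classical
  by_contra! hne
  set S' := S.filter fun m => T m ≠ 0 with hS'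
  have hS'ne : S'.Nonempty := by
    obtain ⟨m, hm, hT⟩ := hne
    exact ⟨m, by simp [hS', hm, hT]⟩
  have h' (g : G) : ∑ m ∈ S', LinearMap.trace ℂ _ (T m ∘ₗ simpleG m g) = 0 := by
    rw [← h g, hS']
    refine Finset.sum_filter_of_ne fun m _ hm h0 => hm ?_
    rw [h0]
    simp
  -- With this bound, the weights `code M m` separate the elements of `S'`.
  let M := S'.sup (fun m => m 0 + m 1 + m 2) + 1
  have hM {m} (hm : m ∈ S') (i : Fin 3) : m i < M := by
    have : m 0 + m 1 + m 2 ≤ S'.sup (fun m => m 0 + m 1 + m 2) :=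
      Finset.le_sup (f := fun m : Fin 3 → ℕ => m 0 + m 1 + m 2) hm
    fin_cases i <;> simp [M] <;> omega
  obtain ⟨m, hm, hmax⟩ := S'.exists_max_image (code M) hS'ne
  have hTm : T m ≠ 0 := (Finset.mem_filter.1 hm).2
  refine hTm (tripleHom_ext (m := m) fun v hv => ?_)
  rw [LinearMap.zero_apply]
  refine eq_zero_of_evalTripleForm fun w hw => ?_
  choose x hx using fun i => exists_SL2_col (hv i)
  choose y hy using fun i => exists_SL2_row (hw i)
  have hcoef := repr_last_eq_evalTripleForm m (T m) x y
  simp only [hx, hy] at hcoef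
  rw [← hcoef]
  let s (n : Fin 3 → ℕ) (a : Fin (n 0 + 1) × Fin (n 1 + 1) × Fin (n 2 + 1)) : ℂ :=
    (tripleBasis n).repr (simpleG n y (T n (simpleG n x (tripleBasis n a)))) a
  have htrace (t : ℂˣ) (n : Fin 3 → ℕ) : (t : ℂ) ^ code M n *
      LinearMap.trace ℂ _ (T n ∘ₗ simpleG n (x * tripleTorus M t * y)) =
        ∑ a, s n a * (t : ℂ) ^ (2 * code M ![a.1, a.2.1, a.2.2]) := by
    have : LinearMap.trace ℂ _ (T n ∘ₗ simpleG n (x * tripleTorus M t * y)) =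
        LinearMap.trace ℂ _ ((simpleG n y * T n * simpleG n x) * simpleG n (tripleTorus M t)) := by
      rw [map_mul, map_mul, ← Module.End.mul_eq_comp, ← mul_assoc, ← mul_assoc,
        LinearMap.trace_mul_comm]
      simp only [mul_assoc]
    rw [this, trace_eq_sum_repr (tripleBasis n), Finset.mul_sum]
    refine Finset.sum_congr rfl fun a _ => ?_
    have := congrArg (fun z => (tripleBasis n).repr ((simpleG n y * T n * simpleG n x) z) a)
      (simpleG_tripleTorus M t n a)
    simp only [map_smul, Finsupp.smul_apply, smul_eq_mul] at this
    rw [Module.End.mul_apply, this, mul_comm]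
    rfl
  -- The relation at `x λ(t) y`, multiplied by `t ^ code M m` to clear the negative exponents.
  let P : Polynomial ℂ := ∑ n ∈ S', ∑ a, Polynomial.C (s n a) *
    Polynomial.X ^ (code M m - code M n + 2 * code M ![a.1, a.2.1, a.2.2])
  have hP : P = 0 := by
    refine mul_right_cancel₀ Polynomial.X_ne_zero (Polynomial.funext fun t => ?_)
    by_cases ht : t = 0
    · simp [ht]
    suffices P.eval t = 0 by simp [this]
    obtain ⟨t, rfl⟩ : IsUnit t := isUnit_iff_ne_zero.2 ht
    have := congrArg ((t : ℂ) ^ code M m * ·) (h' (x * tripleTorus M t * y))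
    simp only [Finset.mul_sum, mul_zero] at this
    rw [← this, Polynomial.eval_finsetSum]
    refine Finset.sum_congr rfl fun n hn => ?_
    rw [← Nat.sub_add_cancel (hmax n hn), pow_add, mul_assoc, htrace, Polynomial.eval_finsetSum,
      Finset.mul_sum, Nat.sub_add_cancel (hmax n hn)]
    refine Finset.sum_congr rfl fun a _ => ?_
    simp only [Polynomial.eval_mul, Polynomial.eval_C, Polynomial.eval_pow, Polynomial.eval_X,
      pow_add]
    ring
  have := congrArg (fun p => p.coeff (2 * code M m)) hP
  simp only [P, Polynomial.finsetSum_coeff, Polynomial.coeff_C_mul, Polynomial.coeff_X_pow,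
    Polynomial.coeff_zero] at this
  have hle (n : Fin 3 → ℕ) (a : Fin (n 0 + 1) × Fin (n 1 + 1) × Fin (n 2 + 1)) :
      code M ![a.1, a.2.1, a.2.2] ≤ code M n := by
    have h0 := Nat.lt_succ_iff.1 a.1.2
    have h1 := Nat.lt_succ_iff.1 a.2.1.2
    have h2 := Nat.lt_succ_iff.1 a.2.2.2
    simp only [code]
    exact Nat.add_le_add h0 (Nat.mul_le_mul_left _ (Nat.add_le_add h1 (Nat.mul_le_mul_left _ h2)))
  -- The exponent `2 * code M m` is reached only by the highest weight vector of `V(m)`.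
  rw [Finset.sum_eq_single m, Finset.sum_eq_single (Fin.last _, Fin.last _, Fin.last _)] at this
  · rw [if_pos, mul_one] at this
    · exact this
    · have : (![((Fin.last (m 0) : Fin _) : ℕ), (Fin.last (m 1) : Fin _),
          (Fin.last (m 2) : Fin _)] : Fin 3 → ℕ) = m := by
        funext i; fin_cases i <;> simp
      simp only [this]
      omega
  · intro a _ ha
    rw [if_neg, mul_zero]
    intro he
    have hca : code M ![a.1, a.2.1, a.2.2] = code M m := by omega
    have hlt (i : Fin 3) : (![(a.1 : ℕ), a.2.1, a.2.2] : Fin 3 → ℕ) i < M := by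
      have h0 := Nat.lt_succ_iff.1 a.1.2
      have h1 := Nat.lt_succ_iff.1 a.2.1.2
      have h2 := Nat.lt_succ_iff.1 a.2.2.2
      have m0 := hM hm 0
      have m1 := hM hm 1
      have m2 := hM hm 2
      fin_cases i <;> simp <;> omega
    have e := code_injOn hlt (hM hm) hca
    have e0 := congrFun e 0
    have e1 := congrFun e 1
    have e2 := congrFun e 2
    simp at e0 e1 e2
    exact ha (Prod.ext (Fin.ext e0) (Prod.ext (Fin.ext e1) (Fin.ext e2)))
  · simp
  · intro n hn hnm
    refine Finset.sum_eq_zero fun a _ => ?_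
    rw [if_neg, mul_zero]
    intro he
    have h1 := hle n a
    have h2 := hmax n hn
    exact hnm (code_injOn (hM hn) (hM hm) (by omega))
  · exact fun h => absurd hm h

/-! ### The copies of the simple modules in the invariant ring -/

/-- The matrix coefficients `g ↦ η (g⁻¹ p)` of `V(m)` attached to a functional `η`. -/
def matCoeff (m : Fin 3 → ℕ) (η : Module.Dual ℂ (TripleForm m)) : TripleForm m →ₗ[ℂ] (G → ℂ) :=
  LinearMap.pi fun g => η ∘ₗ simpleG m g⁻¹

theorem matCoeff_apply (m : Fin 3 → ℕ) (η : Module.Dual ℂ (TripleForm m)) (p : TripleForm m)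
    (g : G) : matCoeff m η p g = η (simpleG m g⁻¹ p) := rfl

/-- The matrix coefficients of `V(m)` in the form `g ↦ tr (T ρ(g⁻¹))`, for operators `T`. -/
def traceCoeff (m : Fin 3 → ℕ) : Module.End ℂ (TripleForm m) →ₗ[ℂ] (G → ℂ) :=
  LinearMap.pi fun g => LinearMap.trace ℂ _ ∘ₗ LinearMap.lcomp ℂ _ (simpleG m g⁻¹)

theorem traceCoeff_apply (m : Fin 3 → ℕ) (T : Module.End ℂ (TripleForm m)) (g : G) :
    traceCoeff m T g = LinearMap.trace ℂ _ (T ∘ₗ simpleG m g⁻¹) := rfl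

/-- Matrix coefficients are the traces attached to operators of rank one. -/
theorem traceCoeff_rankOne (m : Fin 3 → ℕ) (η : Module.Dual ℂ (TripleForm m)) (p : TripleForm m) :
    traceCoeff m (η.smulRight p) = matCoeff m η p := by
  funext g
  have : (η.smulRight p) ∘ₗ simpleG m g⁻¹ =
      dualTensorHom ℂ (TripleForm m) (TripleForm m) ((η ∘ₗ simpleG m g⁻¹) ⊗ₜ[ℂ] p) := by
    ext x
    simp
  rw [traceCoeff_apply, this]
  exact (LinearMap.trace_eq_contract_apply (R := ℂ) (M := TripleForm m) _).trans
    (contractLeft_apply _ _)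

theorem eq_zero_of_sum_traceCoeff {S : Finset (Fin 3 → ℕ)}
    {T : ∀ m, Module.End ℂ (TripleForm m)} (h : ∑ m ∈ S, traceCoeff m (T m) = 0) :
    ∀ m ∈ S, T m = 0 := by
  refine eq_zero_of_sum_trace fun g => ?_
  have := congrFun h g⁻¹
  simpa [traceCoeff_apply] using this

theorem span_triplePow (m : Fin 3 → ℕ) : Submodule.span ℂ (Set.range (triplePow m)) = ⊤ := by
  rw [← Submodule.ker_mkQ (Submodule.span ℂ (Set.range (triplePow m))), LinearMap.ker_eq_top]
  refine tripleHom_ext fun v _ => ?_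
  rw [LinearMap.zero_apply, Submodule.mkQ_apply, Submodule.Quotient.mk_eq_zero]
  exact Submodule.subset_span ⟨v, rfl⟩

theorem entry_mem_coordRing (i : Fin 3) (a b : Fin 2) :
    (fun g : G => (g i).1 a b) ∈ coordRing := Algebra.subset_adjoin ⟨i, a, b, rfl⟩

theorem inv_entry_mem_coordRing (i : Fin 3) (a b : Fin 2) :
    (fun g : G => ((g⁻¹) i).1 a b) ∈ coordRing := by
  have hneg (a b : Fin 2) : (fun g : G => -(g i).1 a b) ∈ coordRing :=
    neg_mem (entry_mem_coordRing i a b)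
  fin_cases a <;> fin_cases b <;>
    simp only [Pi.inv_apply, Matrix.SpecialLinearGroup.coe_inv, Matrix.adjugate_fin_two]
  · exact entry_mem_coordRing i 1 1
  · exact hneg 0 1
  · exact hneg 1 0
  · exact entry_mem_coordRing i 0 0

theorem mulVec_entry_mem_coordRing (v : Fin 3 → Fin 2 → ℂ) (x : Fin 3 × Fin 2) :
    (fun g : G => ((g⁻¹) x.1).1.mulVec (v x.1) x.2) ∈ coordRing := by
  have : (fun g : G => ((g⁻¹) x.1).1.mulVec (v x.1) x.2) =
      ∑ b, v x.1 b • fun g : G => ((g⁻¹) x.1).1 x.2 b := by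
    funext g
    simp only [Matrix.mulVec, dotProduct, Finset.sum_apply, Pi.smul_apply, smul_eq_mul, mul_comm]
  rw [this]
  exact sum_mem fun b _ => Subalgebra.smul_mem _ (inv_entry_mem_coordRing _ _ _) _

theorem matCoeff_mem_coordRing (m : Fin 3 → ℕ) (η : Module.Dual ℂ (TripleForm m))
    (p : TripleForm m) : matCoeff m η p ∈ coordRing := by
  suffices h : (⊤ : Submodule ℂ (TripleForm m)) ≤
      (Subalgebra.toSubmodule coordRing).comap (matCoeff m η) from h Submodule.mem_top
  rw [← span_triplePow, Submodule.span_le]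
  rintro _ ⟨v, rfl⟩
  obtain ⟨P, hP⟩ := exists_polynomial_triplePow η
  have : matCoeff m η (triplePow m v) =
      MvPolynomial.aeval (fun x : Fin 3 × Fin 2 => fun g : G => ((g⁻¹) x.1).1.mulVec (v x.1) x.2)
        P := by
    funext g
    rw [matCoeff_apply, simpleG_triplePow, hP]
    have := MvPolynomial.comp_aeval_apply (B := ℂ)
      (fun x : Fin 3 × Fin 2 => fun g : G => ((g⁻¹) x.1).1.mulVec (v x.1) x.2)
      (Pi.evalAlgHom ℂ (fun _ : G => ℂ) g) P
    rw [MvPolynomial.aeval_eq_eval] at this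
    exact this.symm
  rw [SetLike.mem_coe, Submodule.mem_comap, this, Subalgebra.mem_toSubmodule]
  clear hP this
  induction P using MvPolynomial.induction_on with
  | C c =>
    rw [MvPolynomial.aeval_C]
    exact algebraMap_mem _ c
  | add p q hp hq =>
    rw [map_add]
    exact add_mem hp hq
  | mul_X p x hp =>
    rw [map_mul, MvPolynomial.aeval_X]
    exact mul_mem hp (mulVec_entry_mem_coordRing v x)

theorem matCoeff_bracketForm_mem (d : Fin 3 → ℕ) (p : TripleForm (weight d)) :
    matCoeff (weight d) (bracketForm d) p ∈ invRing := by
  refine ⟨matCoeff_mem_coordRing _ _ _, fun g h => ?_⟩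
  have : (fun i => g i * h)⁻¹ = (fun _ : Fin 3 => h⁻¹) * g⁻¹ := by
    funext i
    simp
  rw [matCoeff_apply, this, map_mul, Module.End.mul_apply, bracketForm_simpleG, matCoeff_apply]

/-- The embedding of `V(m)`, `m` the weight of `d`, into the invariant ring by means of the matrix
coefficients attached to the invariant functional. -/
def bracketMap (d : Fin 3 → ℕ) :
    Representation.IntertwiningMap (simpleG (weight d)) leftRep :=
  LinearMap.intertwiningMap_of_isIntertwiningMap (simpleG (weight d)) leftRep
    ((matCoeff (weight d) (bracketForm d)).codRestrict (Subalgebra.toSubmodule invRing)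
      (matCoeff_bracketForm_mem d)) fun x p => by
    ext g
    change matCoeff _ _ _ g = matCoeff _ _ _ (x⁻¹ * g)
    rw [matCoeff_apply, matCoeff_apply, mul_inv_rev, inv_inv, map_mul, Module.End.mul_apply]

theorem bracketMap_coe (d : Fin 3 → ℕ) (p : TripleForm (weight d)) :
    (bracketMap d p : G → ℂ) = matCoeff (weight d) (bracketForm d) p := rfl

theorem bracketMap_injective (d : Fin 3 → ℕ) : Function.Injective (bracketMap d) := by
  refine (injective_iff_map_eq_zero _).2 fun p hp => ?_
  have h0 : matCoeff (weight d) (bracketForm d) p = 0 := by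
    rw [← bracketMap_coe, hp]
    rfl
  rw [← traceCoeff_rankOne] at h0
  have := eq_zero_of_sum_trace (S := {weight d})
    (T := Function.update (fun _ => 0) (weight d) ((bracketForm d).smulRight p)) (fun g => by
      simpa [traceCoeff_apply] using congrFun h0 g⁻¹) (weight d) (by simp)
  rw [Function.update_self] at this
  by_contra hp0
  refine bracketForm_ne_zero d (LinearMap.ext fun x => ?_)
  have := LinearMap.congr_fun this x
  rw [LinearMap.smulRight_apply, LinearMap.zero_apply] at this
  exact (smul_eq_zero.1 this).resolve_right hp0

/-- By Frobenius reciprocity, an equivariant map from `V(m)` to the invariant ring is a multiple of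
the embedding given by the brackets. -/
theorem intertwining_eq_smul_bracketMap {d : Fin 3 → ℕ}
    (φ : Representation.IntertwiningMap (simpleG (weight d)) leftRep) :
    ∃ c : ℂ, ∀ p, φ p = c • bracketMap d p := by
  let η : Module.Dual ℂ (TripleForm (weight d)) :=
    { toFun := fun p => (φ p).1 1
      map_add' := fun p q => by rw [map_add]; rfl
      map_smul' := fun c p => by rw [map_smul]; rfl }
  have hφ (g : G) (p) : η (simpleG (weight d) g⁻¹ p) = (φ p).1 g := by
    change (φ _).1 1 = _
    rw [φ.isIntertwining]
    change (φ p).1 ((g⁻¹)⁻¹ * 1) = _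
    rw [inv_inv, mul_one]
  obtain ⟨c, hc⟩ := invariant_eq_smul_bracketForm (η := η) fun h p => by
    have h1 := hφ (fun _ => h⁻¹) p
    have h2 := (φ p).2.2 1 h⁻¹
    simp only [Pi.one_apply, one_mul] at h2
    rw [h2, ← hφ 1] at h1
    have h3 : (fun _ : Fin 3 => h⁻¹)⁻¹ = fun _ => h := by funext; simp
    rwa [h3, inv_one, map_one, Module.End.one_apply] at h1
  refine ⟨c, fun p => ?_⟩
  ext g
  rw [← hφ, hc]
  rfl

theorem nonempty_range_equiv (d : Fin 3 → ℕ) :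
    Nonempty ((bracketMap d).range.toRepresentation.Equiv (simpleG (weight d))) :=
  ⟨(Representation.Equiv.mk (σ := (bracketMap d).range.toRepresentation)
    (LinearEquiv.ofInjective (bracketMap d).toLinearMap (bracketMap_injective d)) fun g =>
      LinearMap.ext fun p => Subtype.ext ((bracketMap d).isIntertwining _ _ g p)).symm⟩

/-- The isotypic component of type `V(m)` is a single copy of `V(m)`, since all equivariant maps
from `V(m)` are proportional. -/
theorem component_eq_range (d : Fin 3 → ℕ) : component (weight d) = (bracketMap d).range := by
  apply Subrepresentation.toSubmodule_injective
  apply le_antisymm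
  · refine sSup_le ?_
    rintro _ ⟨S, rfl, ⟨e⟩⟩ x hx
    let φ : Representation.IntertwiningMap (simpleG (weight d)) leftRep :=
      LinearMap.intertwiningMap_of_isIntertwiningMap (simpleG (weight d)) leftRep
        (S.toSubmodule.subtype ∘ₗ e.symm.toLinearMap) fun g p => by
        change ((e.symm (simpleG (weight d) g p) : S.toSubmodule) : invRing) = _
        rw [show e.symm (simpleG (weight d) g p) = S.toRepresentation g (e.symm p) from
          Representation.IntertwiningMap.isIntertwining _ _ e.symm.toIntertwiningMap g p]
        rfl
    obtain ⟨c, hc⟩ := intertwining_eq_smul_bracketMap φ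
    refine ⟨c • e ⟨x, hx⟩, ?_⟩
    change bracketMap d (c • e ⟨x, hx⟩) = x
    rw [map_smul, ← hc]
    change ((e.symm (e ⟨x, hx⟩) : S.toSubmodule) : invRing) = x
    rw [e.symm_apply_apply]
  · exact le_sSup ⟨(bracketMap d).range, rfl, nonempty_range_equiv d⟩

theorem nonempty_component_equiv (d : Fin 3 → ℕ) :
    Nonempty ((component (weight d)).toRepresentation.Equiv (simpleG (weight d))) := by
  rw [component_eq_range]
  exact nonempty_range_equiv d

/-! ### The tensor semigroup -/

/-- The rotation of the plane that turns the bracket into the dot product. -/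
def rot (v : Fin 2 → ℂ) : Fin 2 → ℂ := ![v 1, -v 0]

theorem vecMul_rot_mulVec (g : SL2) (v : Fin 2 → ℂ) :
    Matrix.vecMul (rot (g.1.mulVec v)) g.1 = rot v := by
  have hg := g.2
  rw [Matrix.det_fin_two] at hg
  ext i
  fin_cases i <;>
    simp [rot, Matrix.mulVec, Matrix.vecMul, dotProduct, Fin.sum_univ_two]
  · linear_combination (v 1) * hg
  · linear_combination (-v 0) * hg

/-- The pairing of `p` with pure powers that defines the invariant bilinear form exists: for powers
`p` it is up to sign an evaluation, and these span. -/
theorem exists_dual_evalForm (k : ℕ) (p : BinForm k) :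
    ∃ f : Module.Dual ℂ (BinForm k), ∀ v, f (powForm k v) = evalForm k (rot v) p := by
  let L : Module.Dual ℂ (BinForm k) →ₗ[ℂ] ((Fin 2 → ℂ) → ℂ) :=
    LinearMap.pi fun v => Module.Dual.eval ℂ (BinForm k) (powForm k v)
  let R : BinForm k →ₗ[ℂ] ((Fin 2 → ℂ) → ℂ) := LinearMap.pi fun v => evalForm k (rot v)
  suffices h : (⊤ : Submodule ℂ (BinForm k)) ≤ (LinearMap.range L).comap R by
    obtain ⟨f, hf⟩ := h (Submodule.mem_top (x := p))
    exact ⟨f, fun v => congrFun hf v⟩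
  rw [← span_powForm, Submodule.span_le]
  rintro _ ⟨s, rfl⟩
  refine ⟨(-1 : ℂ) ^ k • evalForm k (rot ![s, 1]), ?_⟩
  funext v
  change (-1 : ℂ) ^ k * evalForm k (rot ![s, 1]) (powForm k v) = evalForm k (rot v) (powForm k _)
  rw [evalForm_powForm, evalForm_powForm, ← mul_pow]
  congr 1
  simp [rot, dotProduct, Fin.sum_univ_two]
  ring

theorem exists_dualForm (k : ℕ) : ∃ β : BinForm k →ₗ[ℂ] Module.Dual ℂ (BinForm k),
    ∀ p v, β p (powForm k v) = evalForm k (rot v) p := by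
  choose f hf using fun a => exists_dual_evalForm k (formBasis k a)
  refine ⟨(formBasis k).constr ℂ f, fun p v => ?_⟩
  have : (Module.Dual.eval ℂ _ (powForm k v)) ∘ₗ (formBasis k).constr ℂ f =
      evalForm k (rot v) := (formBasis k).ext fun a => by simp [hf]
  exact LinearMap.congr_fun this p

/-- The invariant bilinear form on `V(k)`, given by `⟨p, v ^ k⟩ = p (rot v)`. -/
def dualForm (k : ℕ) : BinForm k →ₗ[ℂ] Module.Dual ℂ (BinForm k) := (exists_dualForm k).choose

theorem dualForm_powForm (k : ℕ) (p : BinForm k) (v : Fin 2 → ℂ) :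
    dualForm k p (powForm k v) = evalForm k (rot v) p := (exists_dualForm k).choose_spec p v

theorem dualForm_simpleSL2 (k : ℕ) (h : SL2) (p q : BinForm k) :
    dualForm k (simpleSL2 k h p) (simpleSL2 k h q) = dualForm k p q := by
  have : dualForm k (simpleSL2 k h p) ∘ₗ simpleSL2 k h = dualForm k p :=
    formHom_ext fun v _ => by
      rw [LinearMap.comp_apply, simpleSL2_powForm, dualForm_powForm, dualForm_powForm,
        evalForm_simpleSL2, vecMul_rot_mulVec]
  exact LinearMap.congr_fun this q

theorem dualForm_injective (k : ℕ) : Function.Injective (dualForm k) := by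
  refine (injective_iff_map_eq_zero _).2 fun p hp => eq_zero_of_evalForm fun w _ => ?_
  have := dualForm_powForm k p ![-w 1, w 0]
  rw [hp] at this
  have hw : rot ![-w 1, w 0] = w := by ext i; fin_cases i <;> simp [rot]
  rw [hw] at this
  exact this.symm

/-- The self-duality of `V(a) ⊗ V(b)` given by the invariant bilinear forms of both factors. -/
def pairEquiv (a b : ℕ) :
    BinForm a ⊗[ℂ] BinForm b ≃ₗ[ℂ] Module.Dual ℂ (BinForm a ⊗[ℂ] BinForm b) :=
  (TensorProduct.congr
    (LinearEquiv.ofInjectiveOfFinrankEq (dualForm a) (dualForm_injective a)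
      Subspace.dual_finrank_eq.symm)
    (LinearEquiv.ofInjectiveOfFinrankEq (dualForm b) (dualForm_injective b)
      Subspace.dual_finrank_eq.symm)).trans
    (TensorProduct.dualDistribEquiv ℂ (BinForm a) (BinForm b))

theorem pairEquiv_tmul (a b : ℕ) (p p' : BinForm a) (q q' : BinForm b) :
    pairEquiv a b (p ⊗ₜ q) (p' ⊗ₜ q') = dualForm a p p' * dualForm b q q' := rfl

theorem pairEquiv_tprod (a b : ℕ) (h : SL2) (s t : BinForm a ⊗[ℂ] BinForm b) :
    pairEquiv a b ((simpleSL2 a).tprod (simpleSL2 b) h s)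
      ((simpleSL2 a).tprod (simpleSL2 b) h t) = pairEquiv a b s t := by
  induction s with
  | zero => simp
  | add s s' hs hs' => simp only [map_add, LinearMap.add_apply, hs, hs']
  | tmul p q =>
    induction t with
    | zero => simp
    | add s s' hs hs' => simp only [map_add, hs, hs']
    | tmul p' q' =>
      simp only [Representation.tprod_apply, TensorProduct.map_tmul, pairEquiv_tmul,
        dualForm_simpleSL2]

/-- The tensor semigroup consists of the weights of the line bundles on the wonderful
compactification: by self-duality, equivariant maps `V(m₂) → V(m₀) ⊗ V(m₁)` correspond to invariant
functionals on `V(m)`. -/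
theorem range_weight : Set.range weight = tensorSemigroup := by
  ext m
  constructor
  · rintro ⟨d, rfl⟩
    set m := weight d with hm
    let F : BinForm (m 2) →ₗ[ℂ] Module.Dual ℂ (BinForm (m 0) ⊗[ℂ] BinForm (m 1)) :=
      (TensorProduct.curry (bracketForm d ∘ₗ (TensorProduct.assoc ℂ _ _ _).toLinearMap)).flip
    have hF (r p q) : F r (p ⊗ₜ q) = bracketForm d (p ⊗ₜ (q ⊗ₜ r)) := rfl
    have hFinv (h : SL2) (r t) : F (simpleSL2 (m 2) h r)
        ((simpleSL2 (m 0)).tprod (simpleSL2 (m 1)) h t) = F r t := by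
      induction t with
      | zero => simp
      | add s s' hs hs' => simp only [map_add, hs, hs']
      | tmul p q =>
        rw [Representation.tprod_apply, TensorProduct.map_tmul, hF, hF]
        exact bracketForm_simpleG d h (p ⊗ₜ (q ⊗ₜ r))
    have hint (h : SL2) (r) : (pairEquiv (m 0) (m 1)).symm (F (simpleSL2 (m 2) h r)) =
        (simpleSL2 (m 0)).tprod (simpleSL2 (m 1)) h ((pairEquiv (m 0) (m 1)).symm (F r)) := by
      rw [LinearEquiv.symm_apply_eq]
      refine LinearMap.ext fun t => ?_
      have ht : t = (simpleSL2 (m 0)).tprod (simpleSL2 (m 1)) h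
          ((simpleSL2 (m 0)).tprod (simpleSL2 (m 1)) h⁻¹ t) := by
        rw [← Module.End.mul_apply, ← map_mul, mul_inv_cancel, map_one, Module.End.one_apply]
      rw [ht, hFinv, pairEquiv_tprod, LinearEquiv.apply_symm_apply]
    refine ⟨LinearMap.intertwiningMap_of_isIntertwiningMap (simpleSL2 (m 2))
      ((simpleSL2 (m 0)).tprod (simpleSL2 (m 1)))
      ((pairEquiv (m 0) (m 1)).symm.toLinearMap ∘ₗ F) hint, ?_⟩
    refine (injective_iff_map_eq_zero _).2 fun r hr => ?_
    have hr : F r = 0 := (LinearEquiv.map_eq_zero_iff (pairEquiv (m 0) (m 1)).symm).1 hr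
    have hrh (h : SL2) : F (simpleSL2 (m 2) h r) = 0 := by
      rw [← LinearEquiv.map_eq_zero_iff (pairEquiv (m 0) (m 1)).symm, hint, hr]
      simp
    set e : (k : ℕ) → BinForm k := fun k => powForm k ![1, 0]
    -- If `r` is in the kernel, then so are its translates, and therefore the matrix coefficients of
    -- all `p ⊗ q ⊗ r` vanish.
    have hx : bracketMap d (e _ ⊗ₜ (e _ ⊗ₜ r)) = 0 := by
      ext g
      rw [bracketMap_coe, matCoeff_apply, simpleG_tmul, ← hF, hrh]
      rfl
    have hx0 := (map_eq_zero_iff _ (bracketMap_injective d)).1 hx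
    refine eq_zero_of_evalForm fun w _ => ?_
    have := congrArg (evalTripleForm _ ![![1, 0], ![1, 0], w]) hx0
    simpa [evalTripleForm, e, evalForm_powForm] using this
  · rintro ⟨f, hf⟩
    let F : BinForm (m 2) →ₗ[ℂ] Module.Dual ℂ (BinForm (m 0) ⊗[ℂ] BinForm (m 1)) :=
      (pairEquiv (m 0) (m 1)).toLinearMap ∘ₗ f.toLinearMap
    let η : Module.Dual ℂ (TripleForm m) :=
      (TensorProduct.lift F.flip) ∘ₗ (TensorProduct.assoc ℂ _ _ _).symm.toLinearMap
    have hη (p q r) : η (p ⊗ₜ (q ⊗ₜ r)) = pairEquiv (m 0) (m 1) (f r) (p ⊗ₜ q) := rfl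
    have hinv (h : SL2) (x) : η (simpleG m (fun _ => h) x) = η x := by
      refine LinearMap.congr_fun (f := η ∘ₗ simpleG m fun _ => h) (tripleHom_ext fun v _ => ?_) x
      rw [LinearMap.comp_apply, triplePow, simpleG_tmul, hη, f.isIntertwining]
      exact pairEquiv_tprod _ _ h _ (powForm (m 0) (v 0) ⊗ₜ powForm (m 1) (v 1))
    have hη0 : η ≠ 0 := by
      intro h0
      have h1 : f (powForm (m 2) ![1, 0]) = 0 := by
        rw [← LinearEquiv.map_eq_zero_iff (pairEquiv (m 0) (m 1))]
        refine TensorProduct.ext' fun p q => ?_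
        rw [← hη, h0]
        rfl
      have h2 := congrArg (evalForm (m 2) ![1, 0]) ((map_eq_zero_iff f hf).1 h1)
      simp [evalForm_powForm] at h2
    obtain ⟨d, hd, -⟩ := invariant_eq_brackets hη0 hinv
    exact ⟨d, hd.symm⟩

/-! ### Regular functions are sums of matrix coefficients -/

/-- The span of the entries of the `i`-th matrix, as functions on `G`. -/
def entrySpan (i : Fin 3) : Submodule ℂ (G → ℂ) :=
  Submodule.span ℂ {f | ∃ a b, f = fun g => (g i).1 a b}

/-- The regular functions on `G` that are given by multihomogeneous polynomials of multidegree `m`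
in the three matrices. -/
def degreePart (m : Fin 3 → ℕ) : Submodule ℂ (G → ℂ) := ∏ i, entrySpan i ^ m i

theorem degreePart_mul (m n : Fin 3 → ℕ) : degreePart m * degreePart n = degreePart (m + n) := by
  simp only [degreePart, ← Finset.prod_mul_distrib, Pi.add_apply, pow_add]

/-- The matrix coefficients of `V(k)` for the `i`-th factor of `G`, spanned by those of a pure power
and an evaluation. -/
def factorCoeff (i : Fin 3) (k : ℕ) : Submodule ℂ (G → ℂ) :=
  Submodule.span ℂ {f | ∃ u v, f = fun g => (u ⬝ᵥ (g⁻¹ i).1.mulVec v) ^ k}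

/-- The matrix coefficients of arbitrary forms and functionals. -/
theorem apply_simpleSL2_mem_factorCoeff (i : Fin 3) (k : ℕ) (ξ : Module.Dual ℂ (BinForm k))
    (p : BinForm k) : (fun g : G => ξ (simpleSL2 k (g⁻¹ i) p)) ∈ factorCoeff i k := by
  let B : Module.Dual ℂ (BinForm k) →ₗ[ℂ] BinForm k →ₗ[ℂ] (G → ℂ) :=
    { toFun := fun ξ => LinearMap.pi fun g => ξ ∘ₗ simpleSL2 k (g⁻¹ i)
      map_add' := fun _ _ => rfl
      map_smul' := fun _ _ => rfl }
  have h1 (w) (p) : B (evalForm k w) p ∈ factorCoeff i k := by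
    suffices h : (⊤ : Submodule ℂ (BinForm k)) ≤ (factorCoeff i k).comap (B (evalForm k w)) from
      h Submodule.mem_top
    rw [← span_powForm, Submodule.span_le]
    rintro _ ⟨s, rfl⟩
    refine Submodule.subset_span ⟨w, ![s, 1], ?_⟩
    funext g
    change evalForm k w (simpleSL2 k (g⁻¹ i) _) = _
    rw [simpleSL2_powForm, evalForm_powForm]
  suffices h : (⊤ : Submodule ℂ (Module.Dual ℂ (BinForm k))) ≤
      (factorCoeff i k).comap (B.flip p) from h (Submodule.mem_top (x := ξ))
  rw [← span_evalForm, Submodule.span_le]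
  rintro _ ⟨w, -, rfl⟩
  exact h1 w p

/-- The functional `p ↦ (∂p/∂u') (u)` on binary forms. -/
def derivForm (k : ℕ) (u u' : Fin 2 → ℂ) : Module.Dual ℂ (BinForm k) :=
  (∑ j, u' j • ((MvPolynomial.aeval u).toLinearMap ∘ₗ (MvPolynomial.pderiv j).toLinearMap)) ∘ₗ
    Submodule.subtype _

/-- The binary form `v ^ k * v'` of degree `k + 1`. -/
def powMulForm (k : ℕ) (v v' : Fin 2 → ℂ) : BinForm (k + 1) :=
  ⟨linForm v ^ k * linForm v', by
    simpa using ((linForm_isHomogeneous v).pow k).mul (linForm_isHomogeneous v')⟩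

theorem simpleSL2_powMulForm (k : ℕ) (g : SL2) (v v' : Fin 2 → ℂ) :
    simpleSL2 (k + 1) g (powMulForm k v v') =
      powMulForm k (g.1.mulVec v) (g.1.mulVec v') := by
  ext1
  simp [simpleSL2_coe, powMulForm, subst_linForm]

theorem derivForm_powMulForm (k : ℕ) (u u' v v' : Fin 2 → ℂ) :
    derivForm (k + 1) u u' (powMulForm k v v') =
      k * (u ⬝ᵥ v) ^ (k - 1) * (u' ⬝ᵥ v) * (u ⬝ᵥ v') + (u ⬝ᵥ v) ^ k * (u' ⬝ᵥ v') := by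
  simp [derivForm, powMulForm, linForm, dotProduct, Fin.sum_univ_two, MvPolynomial.pderiv_X]
  ring

/-- The Clebsch–Gordan rule: the product of a matrix coefficient of `V(k)` and one of `V(1)` is a
sum of matrix coefficients of `V(k + 1)` and `V(k - 1)`. The first one is that of the polarised
power `v ^ k * v'` and a derivative, and the defect is the multiple of `(u · g⁻¹ v) ^ (k - 1)` given
by the brackets. -/
theorem pow_mul_mem_factorCoeff (i : Fin 3) (k : ℕ) (u u' v v' : Fin 2 → ℂ) :
    (fun g : G => (u ⬝ᵥ (g⁻¹ i).1.mulVec v) ^ k * (u' ⬝ᵥ (g⁻¹ i).1.mulVec v')) ∈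
      factorCoeff i (k + 1) ⊔ ⨆ j : {j // j + 1 = k}, factorCoeff i j := by
  have hD := apply_simpleSL2_mem_factorCoeff i (k + 1) (derivForm (k + 1) u u') (powMulForm k v v')
  have hC : (fun g : G => (k : ℂ) * (u ⬝ᵥ (g⁻¹ i).1.mulVec v) ^ (k - 1)) ∈
      ⨆ j : {j // j + 1 = k}, factorCoeff i j := by
    obtain _ | k := k
    · have : (fun g : G => ((0 : ℕ) : ℂ) * (u ⬝ᵥ (g⁻¹ i).1.mulVec v) ^ (0 - 1)) = 0 := by
        funext g
        simp
      rw [this]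
      exact zero_mem _
    · refine Submodule.mem_iSup_of_mem ⟨k, rfl⟩ (Submodule.smul_mem _ ((k + 1 : ℕ) : ℂ)
        (Submodule.subset_span ⟨u, v, rfl⟩))
  have hk : (k : ℂ) + 1 ≠ 0 := by exact_mod_cast k.succ_ne_zero
  have : (fun g : G => (u ⬝ᵥ (g⁻¹ i).1.mulVec v) ^ k * (u' ⬝ᵥ (g⁻¹ i).1.mulVec v')) =
      ((k : ℂ) + 1)⁻¹ • ((fun g : G => derivForm (k + 1) u u'
        (simpleSL2 (k + 1) (g⁻¹ i) (powMulForm k v v'))) +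
        (bracket u u' * bracket v v') •
          fun g : G => (k : ℂ) * (u ⬝ᵥ (g⁻¹ i).1.mulVec v) ^ (k - 1)) := by
    funext g
    simp only [Pi.smul_apply, Pi.add_apply, smul_eq_mul, simpleSL2_powMulForm,
      derivForm_powMulForm]
    rw [eq_inv_mul_iff_mul_eq₀ hk]
    generalize g⁻¹ i = x
    have hx : (u ⬝ᵥ x.1.mulVec v) * (u' ⬝ᵥ x.1.mulVec v') -
        (u' ⬝ᵥ x.1.mulVec v) * (u ⬝ᵥ x.1.mulVec v') = bracket u u' * bracket v v' := by
      have hx := x.2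
      rw [Matrix.det_fin_two] at hx
      simp only [bracket, Matrix.mulVec, dotProduct, Fin.sum_univ_two]
      linear_combination (u 0 * u' 1 - u 1 * u' 0) * (v 0 * v' 1 - v 1 * v' 0) * hx
    have hpow : (k : ℂ) * (u ⬝ᵥ x.1.mulVec v) ^ k =
        k * (u ⬝ᵥ x.1.mulVec v) ^ (k - 1) * (u ⬝ᵥ x.1.mulVec v) := by
      obtain _ | k := k
      · simp
      · simp [pow_succ, mul_assoc]
    linear_combination (u' ⬝ᵥ x.1.mulVec v') * hpow +
      (k * (u ⬝ᵥ x.1.mulVec v) ^ (k - 1)) * hx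
  rw [this]
  exact Submodule.smul_mem _ _ (add_mem (Submodule.mem_sup_left hD)
    (Submodule.smul_mem _ _ (Submodule.mem_sup_right hC)))

theorem exists_entry_eq (a b : Fin 2) : ∃ u v : Fin 2 → ℂ, ∀ (g : G) (i : Fin 3),
    (g i).1 a b = u ⬝ᵥ (g⁻¹ i).1.mulVec v := by
  have h (g : G) (i : Fin 3) :
      (g⁻¹ i).1 = !![(g i).1 1 1, -(g i).1 0 1; -(g i).1 1 0, (g i).1 0 0] := by
    rw [Pi.inv_apply, Matrix.SpecialLinearGroup.coe_inv, Matrix.adjugate_fin_two]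
  fin_cases a <;> fin_cases b
  · exact ⟨![0, 1], ![0, 1], fun g i => by
      rw [h]; simp [Matrix.vecHead, Matrix.vecTail]⟩
  · exact ⟨![1, 0], ![0, -1], fun g i => by
      rw [h]; simp [Matrix.vecHead, Matrix.vecTail]⟩
  · exact ⟨![0, 1], ![-1, 0], fun g i => by
      rw [h]; simp [Matrix.vecHead, Matrix.vecTail]⟩
  · exact ⟨![1, 0], ![1, 0], fun g i => by
      rw [h]; simp [Matrix.vecHead, Matrix.vecTail]⟩

/-- Polynomials of degree `k` in the entries of the `i`-th matrix are sums of matrix coefficients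
of the `V(j)` with `k - j` nonnegative and even. -/
theorem entrySpan_pow_le (i : Fin 3) (k : ℕ) :
    entrySpan i ^ k ≤ ⨆ j : {j // ∃ c, k = j + 2 * c}, factorCoeff i j := by
  induction k with
  | zero =>
    rw [pow_zero, Submodule.one_eq_span, Submodule.span_le, Set.singleton_subset_iff]
    refine Submodule.mem_iSup_of_mem ⟨0, 0, rfl⟩ (Submodule.subset_span ⟨0, 0, ?_⟩)
    funext g
    simp
  | succ k ih =>
    rw [pow_succ]
    refine (mul_le_mul' ih le_rfl).trans ?_
    rw [Submodule.iSup_mul]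
    refine iSup_le fun ⟨j, c, hc⟩ => ?_
    rw [factorCoeff, entrySpan, Submodule.span_mul_span, Submodule.span_le]
    rintro _ ⟨_, ⟨u, v, rfl⟩, _, ⟨a, b, rfl⟩, rfl⟩
    obtain ⟨u', v', h⟩ := exists_entry_eq a b
    have := pow_mul_mem_factorCoeff i j u u' v v'
    simp only [← h] at this
    refine SetLike.le_def.1 (sup_le ?_ (iSup_le fun l => ?_)) this
    · exact le_iSup (fun j : {j // ∃ c, k + 1 = j + 2 * c} => factorCoeff i j) ⟨j + 1, c, by omega⟩
    · exact le_iSup (fun j : {j // ∃ c, k + 1 = j + 2 * c} => factorCoeff i j)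
        ⟨l, c + 1, by have := l.2; omega⟩

theorem factorCoeff_mul_le (n : Fin 3 → ℕ) :
    factorCoeff 0 (n 0) * factorCoeff 1 (n 1) * factorCoeff 2 (n 2) ≤
      LinearMap.range (traceCoeff n) := by
  simp only [factorCoeff, Submodule.span_mul_span]
  rw [Submodule.span_le]
  rintro _ ⟨_, ⟨_, ⟨u0, v0, rfl⟩, _, ⟨u1, v1, rfl⟩, rfl⟩, _, ⟨u2, v2, rfl⟩, rfl⟩
  refine ⟨(evalTripleForm n ![u0, u1, u2]).smulRight (triplePow n ![v0, v1, v2]), ?_⟩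
  rw [traceCoeff_rankOne]
  funext g
  rw [matCoeff_apply, simpleG_triplePow]
  simp only [triplePow, evalTripleForm, TensorProduct.dualDistrib_apply, evalForm_powForm,
    ← mul_assoc]
  rfl

/-- Functions of multidegree `m` are sums of matrix coefficients of the modules `V(n)`, where
`m - n` is nonnegative and even. -/
theorem degreePart_le (m : Fin 3 → ℕ) :
    degreePart m ≤ ⨆ n : {n | EvenLE n m}, LinearMap.range (traceCoeff n.1) := by
  rw [degreePart, Fin.prod_univ_three]
  refine (mul_le_mul' (mul_le_mul' (entrySpan_pow_le 0 (m 0)) (entrySpan_pow_le 1 (m 1)))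
    (entrySpan_pow_le 2 (m 2))).trans ?_
  simp only [Submodule.iSup_mul, Submodule.mul_iSup]
  refine iSup_le fun j0 => iSup_le fun j1 => iSup_le fun j2 => ?_
  refine (factorCoeff_mul_le ![(j2 : ℕ), j1, j0]).trans (le_iSup
    (fun n : {n | EvenLE n m} => LinearMap.range (traceCoeff n.1))
    ⟨![(j2 : ℕ), j1, j0], fun i => ?_⟩)
  fin_cases i
  · exact j2.2
  · exact j1.2
  · exact j0.2

theorem coordRing_le : Subalgebra.toSubmodule coordRing ≤ ⨆ m, degreePart m := by
  have hmul (f g : G → ℂ) (hf : f ∈ ⨆ m, degreePart m) (hg : g ∈ ⨆ m, degreePart m) :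
      f * g ∈ ⨆ m, degreePart m := by
    have := Submodule.mul_mem_mul hf hg
    simp only [Submodule.iSup_mul, Submodule.mul_iSup, degreePart_mul] at this
    exact (iSup_le fun m => iSup_le fun n => le_iSup degreePart _) this
  intro f hf
  induction hf using Algebra.adjoin_induction with
  | mem f hf =>
    obtain ⟨i, a, b, rfl⟩ := hf
    refine Submodule.mem_iSup_of_mem (Pi.single i 1) ?_
    have : degreePart (Pi.single i 1) = entrySpan i := by
      rw [degreePart, Finset.prod_eq_single i]
      · simp
      · intro j _ hj
        simp [hj]
      · simp
    rw [this]
    exact Submodule.subset_span ⟨a, b, rfl⟩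
  | algebraMap c =>
    refine Submodule.mem_iSup_of_mem 0 ?_
    have : degreePart 0 = 1 := by simp [degreePart]
    rw [this]
    exact Submodule.algebraMap_mem c
  | add f g _ _ hf hg => exact add_mem hf hg
  | mul f g _ _ hf hg => exact hmul f g hf hg

theorem eq_of_sum_trace {S : Finset (Fin 3 → ℕ)} {T T' : ∀ m, Module.End ℂ (TripleForm m)}
    (h : ∀ g : G, ∑ m ∈ S, LinearMap.trace ℂ _ (T m ∘ₗ simpleG m g) =
      ∑ m ∈ S, LinearMap.trace ℂ _ (T' m ∘ₗ simpleG m g)) (m) (hm : m ∈ S) : T m = T' m := by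
  have h0 := eq_zero_of_sum_trace (T := fun m => T m + (-1 : ℂ) • T' m) (fun g => by
    simp only [LinearMap.add_comp, LinearMap.smul_comp, map_add, map_smul, smul_eq_mul,
      Finset.sum_add_distrib, ← Finset.mul_sum, h g]
    ring) m hm
  have h1 : (-1 : ℂ) • T' m + T' m = 0 := by
    nth_rewrite 2 [← one_smul ℂ (T' m)]
    rw [← add_smul, neg_add_cancel, zero_smul]
  rw [← add_zero (T m), ← h1, ← add_assoc, h0, zero_add]

/-- An operator on `V(n)` that is invariant under right translation by the diagonal subgroup
vanishes unless `n` is the weight of some `d`. -/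
theorem exists_weight_eq_of_invariant {n : Fin 3 → ℕ} {T : Module.End ℂ (TripleForm n)}
    (hT : ∀ (h : SL2) x, T (simpleG n (fun _ => h) x) = T x) (hT0 : T ≠ 0) : ∃ d, n = weight d := by
  obtain ⟨x, hx⟩ : ∃ x, T x ≠ 0 := by
    by_contra! H
    exact hT0 (LinearMap.ext H)
  obtain ⟨ζ, hζx⟩ : ∃ ζ : Module.Dual ℂ (TripleForm n), ζ (T x) ≠ 0 := by
    by_contra! H
    exact hx ((Module.forall_dual_apply_eq_zero_iff ℂ _).1 H)
  obtain ⟨d, hd, -⟩ := invariant_eq_brackets (η := ζ ∘ₗ T)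
    (fun h0 => hζx (LinearMap.congr_fun h0 x)) fun h x => congrArg ζ (hT h x)
  exact ⟨d, hd⟩

/-- An operator on `V(m)`, `m` the weight of `d`, that is invariant under right translation by the
diagonal subgroup has rank at most one, and factors through the invariant functional. -/
theorem exists_rankOne_of_invariant {d : Fin 3 → ℕ} {T : Module.End ℂ (TripleForm (weight d))}
    (hT : ∀ (h : SL2) x, T (simpleG (weight d) (fun _ => h) x) = T x) :
    ∃ p, T = (bracketForm d).smulRight p := by
  have hker (y) (hy : bracketForm d y = 0) : T y = 0 := by
    refine (Module.forall_dual_apply_eq_zero_iff ℂ _).1 fun ζ => ?_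
    obtain ⟨c, hc⟩ := invariant_eq_smul_bracketForm (η := ζ ∘ₗ T) fun h x => congrArg ζ (hT h x)
    have := LinearMap.congr_fun hc y
    rwa [LinearMap.smul_apply, hy, smul_zero] at this
  obtain ⟨y, hy⟩ : ∃ y, bracketForm d y = 1 := by
    obtain ⟨z, hz⟩ : ∃ z, bracketForm d z ≠ 0 := by
      by_contra! H
      exact bracketForm_ne_zero d (LinearMap.ext H)
    exact ⟨(bracketForm d z)⁻¹ • z, by rw [map_smul, smul_eq_mul, inv_mul_cancel₀ hz]⟩
  refine ⟨T y, LinearMap.ext fun z => ?_⟩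
  have := hker (z - bracketForm d z • y) (by
    rw [map_sub, map_smul, hy, smul_eq_mul, mul_one, sub_self])
  rw [map_sub, map_smul, sub_eq_zero] at this
  exact this

/-- A sum of traces of operators on distinct `V(n)` is invariant under right translation by the
diagonal subgroup only if all the operators are. -/
theorem apply_simpleG_of_invariant {S : Finset (Fin 3 → ℕ)} {T : ∀ n, Module.End ℂ (TripleForm n)}
    (hinv : ∀ (g : G) (h : SL2), (∑ n ∈ S, traceCoeff n (T n)) (fun i => g i * h) =
      (∑ n ∈ S, traceCoeff n (T n)) g) (n) (hn : n ∈ S) (h : SL2) (x : TripleForm n) :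
    T n (simpleG n (fun _ => h) x) = T n x := by
  refine LinearMap.congr_fun (eq_of_sum_trace (S := S)
    (T := fun n => T n * simpleG n (fun _ => h)) (T' := T) (fun g => ?_) n hn) x
  have h1 := hinv g⁻¹ h⁻¹
  have h2 : (fun i => g⁻¹ i * h⁻¹)⁻¹ = (fun _ => h) * g := by funext i; simp
  rw [Finset.sum_apply, Finset.sum_apply] at h1
  simp only [traceCoeff_apply] at h1
  rw [h2, inv_inv] at h1
  rw [← h1]
  refine Finset.sum_congr rfl fun n _ => ?_
  rw [map_mul, ← Module.End.mul_eq_comp, ← Module.End.mul_eq_comp, mul_assoc]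

theorem exists_sum_traceCoeff {S : Set (Fin 3 → ℕ)} {f : G → ℂ}
    (hf : f ∈ ⨆ n : S, LinearMap.range (traceCoeff n.1)) :
    ∃ (F : Finset (Fin 3 → ℕ)) (T : ∀ n, Module.End ℂ (TripleForm n)), (∀ n ∈ F, n ∈ S) ∧
      f = ∑ n ∈ F, traceCoeff n (T n) := by
  classical
  obtain ⟨F, hF, rfl⟩ := (Submodule.mem_iSup_iff_exists_finsupp _ _).1 hf
  choose T' hT' using hF
  let T (n : Fin 3 → ℕ) : Module.End ℂ (TripleForm n) := if h : n ∈ S then T' ⟨n, h⟩ else 0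
  have hT (n : S) : T n.1 = T' n := dif_pos n.2
  refine ⟨F.support.map (Function.Embedding.subtype _), T, by simp +contextual, ?_⟩
  rw [Finset.sum_map, Finsupp.sum]
  refine Finset.sum_congr rfl fun n _ => ?_
  rw [← hT']
  exact (congrArg (traceCoeff n.1) (hT n)).symm

/-- An invariant function which is a sum of matrix coefficients of modules `V(n)` is a sum of
matrix coefficients attached to the invariant functionals of these modules. -/
theorem mem_iSup_range_of_invariant {S : Set (Fin 3 → ℕ)} {f : G → ℂ}
    (hf : f ∈ ⨆ n : S, LinearMap.range (traceCoeff n.1))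
    (hinv : ∀ (g : G) (h : SL2), f (fun i => g i * h) = f g) :
    f ∈ ⨆ d : {d // weight d ∈ S}, LinearMap.range (matCoeff (weight d) (bracketForm d)) := by
  obtain ⟨F, T, hF, rfl⟩ := exists_sum_traceCoeff hf
  refine sum_mem fun n hn => ?_
  have hT := apply_simpleG_of_invariant hinv n hn
  by_cases hT0 : T n = 0
  · rw [hT0, map_zero]
    exact zero_mem _
  obtain ⟨d, rfl⟩ := exists_weight_eq_of_invariant hT hT0
  obtain ⟨p, hp⟩ := exists_rankOne_of_invariant hT
  rw [hp, traceCoeff_rankOne]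
  exact Submodule.mem_iSup_of_mem ⟨d, hF _ hn⟩ ⟨p, rfl⟩

/-! ### The decomposition of the invariant ring -/

/-- The copy of `V(m)`, `m` the weight of `d`, inside the functions on `G`. -/
def bracketPart (d : Fin 3 → ℕ) : Submodule ℂ (G → ℂ) :=
  LinearMap.range (matCoeff (weight d) (bracketForm d))

theorem map_component (d : Fin 3 → ℕ) :
    (component (weight d)).toSubmodule.map invRing.val.toLinearMap = bracketPart d := by
  rw [component_eq_range, bracketPart]
  exact (LinearMap.range_comp _ _).symm

theorem map_val_injective :
    Function.Injective (Submodule.map (invRing.val.toLinearMap : invRing →ₗ[ℂ] (G → ℂ))) :=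
  Submodule.map_injective_of_injective Subtype.val_injective

theorem iSup_component : ⨆ m : tensorSemigroup, (component m.1).toSubmodule = ⊤ := by
  apply map_val_injective
  rw [Submodule.map_iSup]
  apply le_antisymm (iSup_le fun m => Submodule.map_mono le_top)
  rintro _ ⟨f, -, rfl⟩
  have h1 : f.1 ∈ ⨆ n : (Set.univ : Set (Fin 3 → ℕ)), LinearMap.range (traceCoeff n.1) := by
    refine SetLike.le_def.1 (iSup_le fun m => (degreePart_le m).trans (iSup_le fun n => ?_))
      (coordRing_le f.2.1)
    exact le_iSup (fun n : (Set.univ : Set (Fin 3 → ℕ)) => LinearMap.range (traceCoeff n.1))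
      ⟨n.1, trivial⟩
  refine SetLike.le_def.1 (iSup_le fun d => ?_) (mem_iSup_range_of_invariant h1 f.2.2)
  have := le_iSup (fun m : tensorSemigroup =>
    (component m.1).toSubmodule.map invRing.val.toLinearMap)
    ⟨weight d.1, by rw [← range_weight]; exact ⟨d.1, rfl⟩⟩
  simp only [map_component] at this
  exact this

theorem exists_traceCoeff_eq {m : Fin 3 → ℕ} (hm : m ∈ tensorSemigroup) {f : invRing}
    (hf : f ∈ (component m).toSubmodule) : ∃ T, traceCoeff m T = f.1 := by
  obtain ⟨d, rfl⟩ : m ∈ Set.range weight := by rwa [range_weight]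
  have h : f.1 ∈ bracketPart d := by
    rw [← map_component]
    exact ⟨_, hf, rfl⟩
  obtain ⟨p, hp⟩ := h
  exact ⟨_, (traceCoeff_rankOne _ _ p).trans hp⟩

theorem iSupIndep_component :
    iSupIndep fun m : tensorSemigroup => (component m.1).toSubmodule := by
  classical
  rw [iSupIndep_iff_finsetSum_eq_zero_imp_eq_zero]
  intro s v hv hsum
  have hT (m : tensorSemigroup) : ∃ T, m ∈ s → traceCoeff m.1 T = (v m).1 := by
    by_cases hm : m ∈ s
    · obtain ⟨T, hT⟩ := exists_traceCoeff_eq m.2 (hv m hm)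
      exact ⟨T, fun _ => hT⟩
    · exact ⟨0, fun h => absurd h hm⟩
  choose T hT using hT
  let T' (n : Fin 3 → ℕ) : Module.End ℂ (TripleForm n) :=
    if h : n ∈ tensorSemigroup then T ⟨n, h⟩ else 0
  have hT' (n : tensorSemigroup) : T' n.1 = T n := dif_pos n.2
  have h0 : ∑ n ∈ s.map (Function.Embedding.subtype _), traceCoeff n (T' n) = 0 := by
    rw [Finset.sum_map]
    have := congrArg (fun f : invRing => f.1) hsum
    simp only [AddSubmonoidClass.coe_finsetSum] at this
    refine Eq.trans (Finset.sum_congr rfl fun n hn => ?_) this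
    rw [← hT n hn]
    exact congrArg (traceCoeff n.1) (hT' n)
  intro m hm
  have h1 := eq_zero_of_sum_traceCoeff h0 m.1 (Finset.mem_map_of_mem _ hm)
  rw [hT' m] at h1
  apply Subtype.ext
  rw [← hT m hm, h1, map_zero]
  rfl

theorem isInternal_component : DirectSum.IsInternal
    fun m : tensorSemigroup => (component m.1).toSubmodule :=
  DirectSum.isInternal_submodule_of_iSupIndep_of_iSup_eq_top iSupIndep_component iSup_component

theorem map_Gam (m : Fin 3 → ℕ) : (Gam m).map invRing.val.toLinearMap =
    ⨆ d : {d // EvenLE (weight d) m}, bracketPart d.1 := by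
  rw [Gam, Submodule.map_iSup]
  apply le_antisymm
  · refine iSup_le fun ⟨n, hn, hle⟩ => ?_
    obtain ⟨d, rfl⟩ : n ∈ Set.range weight := by rwa [range_weight]
    rw [map_component]
    exact le_iSup (fun d : {d // EvenLE (weight d) m} => bracketPart d.1) ⟨d, hle⟩
  · refine iSup_le fun ⟨d, hd⟩ => ?_
    have := le_iSup (fun n : {n : Fin 3 → ℕ // n ∈ tensorSemigroup ∧ EvenLE n m} =>
      (component n.1).toSubmodule.map invRing.val.toLinearMap)
      ⟨weight d, by rw [← range_weight]; exact ⟨d, rfl⟩, hd⟩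
    simpa only [map_component] using this

/-! ### Polynomials in the entries of the homogeneous coordinates -/

/-- The span of the entries of the `i`-th homogeneous coordinate `gᵢ₊₁ gᵢ₊₂⁻¹`, as functions on
`G`. -/
def matrixSpan (i : Fin 3) : Submodule ℂ (G → ℂ) :=
  Submodule.span ℂ {f | ∃ a b, f = fun g => (orbitMap g).1 i a b}

/-- The functions on `G` given by multihomogeneous polynomials of multidegree `d` in the
homogeneous coordinates. -/
def sectionPart (d : Fin 3 → ℕ) : Submodule ℂ (G → ℂ) := ∏ i, matrixSpan i ^ d i

theorem sectionPart_mul (d e : Fin 3 → ℕ) :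
    sectionPart d * sectionPart e = sectionPart (d + e) := by
  simp only [sectionPart, ← Finset.prod_mul_distrib, Pi.add_apply, pow_add]

theorem orbitMap_apply (g : G) (i : Fin 3) (a b : Fin 2) :
    (orbitMap g).1 i a b = ((g (i + 1)).1 * (g (i + 2)).1.adjugate) a b := by
  simp [orbitMap]

theorem orbitMap_mul (g : G) (h : SL2) : orbitMap (fun i => g i * h) = orbitMap g := by
  apply Subtype.ext
  funext i
  simp [orbitMap]

theorem matrixSpan_le (i : Fin 3) : matrixSpan i ≤ entrySpan (i + 1) * entrySpan (i + 2) := by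
  have he (i : Fin 3) (a b : Fin 2) : (fun g : G => (g i).1 a b) ∈ entrySpan i :=
    Submodule.subset_span ⟨a, b, rfl⟩
  have ha (i : Fin 3) (a b : Fin 2) : (fun g : G => (g i).1.adjugate a b) ∈ entrySpan i := by
    have hn (a b : Fin 2) : (fun g : G => -(g i).1 a b) ∈ entrySpan i := neg_mem (he i a b)
    fin_cases a <;> fin_cases b <;> simp only [Matrix.adjugate_fin_two]
    · exact he i 1 1
    · exact hn 0 1
    · exact hn 1 0
    · exact he i 0 0
  rw [matrixSpan, Submodule.span_le]
  rintro _ ⟨a, b, rfl⟩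
  have : (fun g => (orbitMap g).1 i a b) = ∑ c, (fun g : G => (g (i + 1)).1 a c) *
      fun g : G => (g (i + 2)).1.adjugate c b := by
    funext g
    rw [orbitMap_apply, Matrix.mul_apply, Finset.sum_apply]
    rfl
  rw [this]
  exact sum_mem fun c _ => Submodule.mul_mem_mul (he _ _ _) (ha _ _ _)

theorem sectionPart_le_degreePart (d : Fin 3 → ℕ) : sectionPart d ≤ degreePart (weight d) := by
  calc sectionPart d ≤ ∏ i, (entrySpan (i + 1) * entrySpan (i + 2)) ^ d i :=
        Finset.prod_le_prod' fun i _ => pow_le_pow_left' (matrixSpan_le i) _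
    _ = degreePart (weight d) := by
        simp only [degreePart, Fin.prod_univ_three, weight, mul_pow, pow_add, Fin.isValue,
          zero_add, Fin.reduceAdd]
        ring

theorem apply_mul_of_mem_sectionPart {d : Fin 3 → ℕ} {f : G → ℂ} (hf : f ∈ sectionPart d) (g : G)
    (h : SL2) : f (fun i => g i * h) = f g := by
  let S : Subalgebra ℂ (G → ℂ) :=
    { carrier := {f | ∀ (g : G) (h : SL2), f (fun i => g i * h) = f g}
      mul_mem' := fun {a b} ha hb g h => by simp only [Pi.mul_apply, ha g h, hb g h]
      add_mem' := fun {a b} ha hb g h => by simp only [Pi.add_apply, ha g h, hb g h]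
      algebraMap_mem' := fun c g h => rfl }
  have hmul : Subalgebra.toSubmodule S * Subalgebra.toSubmodule S ≤ Subalgebra.toSubmodule S :=
    Submodule.mul_le.2 fun a ha b hb => S.mul_mem ha hb
  have hS (i : Fin 3) (k : ℕ) : matrixSpan i ^ k ≤ Subalgebra.toSubmodule S := by
    induction k with
    | zero =>
      rw [pow_zero, Submodule.one_le]
      exact one_mem S
    | succ k ih =>
      rw [pow_succ]
      refine (mul_le_mul' ih (Submodule.span_le.2 ?_)).trans hmul
      rintro _ ⟨a, b, rfl⟩ g h
      exact congrArg (fun A : ConeX => A.1 i a b) (orbitMap_mul g h)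
  have hle : sectionPart d ≤ Subalgebra.toSubmodule S := by
    rw [sectionPart, Fin.prod_univ_three]
    exact (mul_le_mul' ((mul_le_mul' (hS 0 _) (hS 1 _)).trans hmul) (hS 2 _)).trans hmul
  exact hle hf g h

/-- The brackets of translated vectors are combinations of the entries of the homogeneous
coordinates. -/
theorem tripleBracket_mem_matrixSpan (v : Fin 3 → Fin 2 → ℂ) (i : Fin 3) :
    (fun g : G => tripleBracket (fun j => (g⁻¹ j).1.mulVec (v j)) i) ∈ matrixSpan i := by
  have : (fun g : G => tripleBracket (fun j => (g⁻¹ j).1.mulVec (v j)) i) =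
      ∑ a, ∑ b, (rot (v (i + 1)) a * -v (i + 2) b) • fun g : G => (orbitMap g).1 i a b := by
    funext g
    have h1 : tripleBracket (fun j => (g⁻¹ j).1.mulVec (v j)) i =
        bracket (v (i + 1)) ((orbitMap g).1 i |>.mulVec (v (i + 2))) := by
      have h2 := bracket_mulVec (g (i + 1)).1 ((g⁻¹ (i + 1)).1.mulVec (v (i + 1)))
        ((g⁻¹ (i + 2)).1.mulVec (v (i + 2)))
      rw [(g (i + 1)).2, one_mul, Matrix.mulVec_mulVec, Matrix.mulVec_mulVec,
        ← Matrix.SpecialLinearGroup.coe_mul, ← Matrix.SpecialLinearGroup.coe_mul, Pi.inv_apply,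
        mul_inv_cancel, Matrix.SpecialLinearGroup.coe_one, Matrix.one_mulVec] at h2
      exact h2.symm
    rw [h1]
    simp [bracket, rot, Matrix.mulVec, dotProduct, Fin.sum_univ_two]
    ring
  rw [this]
  exact sum_mem fun a _ => sum_mem fun b _ => Submodule.smul_mem _ _
    (Submodule.subset_span ⟨a, b, rfl⟩)

theorem bracketPart_le (d : Fin 3 → ℕ) : bracketPart d ≤ sectionPart d := by
  rw [bracketPart, LinearMap.range_eq_map, ← span_triplePow, Submodule.map_span, Submodule.span_le]
  rintro _ ⟨_, ⟨v, rfl⟩, rfl⟩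
  have : matCoeff (weight d) (bracketForm d) (triplePow (weight d) v) =
      ∏ i, (fun g : G => tripleBracket (fun j => (g⁻¹ j).1.mulVec (v j)) i) ^ d i := by
    funext g
    rw [matCoeff_apply, simpleG_triplePow, bracketForm_triplePow, Finset.prod_apply]
    rfl
  rw [this, sectionPart, Fin.prod_univ_three, Fin.prod_univ_three]
  exact Submodule.mul_mem_mul (Submodule.mul_mem_mul
    (Submodule.pow_mem_pow _ (tripleBracket_mem_matrixSpan v 0) _)
    (Submodule.pow_mem_pow _ (tripleBracket_mem_matrixSpan v 1) _))
    (Submodule.pow_mem_pow _ (tripleBracket_mem_matrixSpan v 2) _)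

/-- The entries of a homogeneous coordinate are up to sign those of the product of the two others,
since `A₀ A₁ A₂ = 1`. -/
theorem matrixSpan_le_mul (i : Fin 3) : matrixSpan i ≤ matrixSpan (i + 1) * matrixSpan (i + 2) := by
  have hmul (g : G) : (orbitMap g).1 i =
      ((orbitMap g).1 (i + 1) * (orbitMap g).1 (i + 2)).adjugate := by
    have i1 : i + 1 + 1 = i + 2 := by rw [add_assoc]; rfl
    have i2 : i + 1 + 2 = i := by rw [add_assoc]; exact add_zero i
    have i3 : i + 2 + 1 = i := by rw [add_assoc]; exact add_zero i
    have i4 : i + 2 + 2 = i + 1 := by rw [add_assoc]; rfl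
    simp only [orbitMap, ← Matrix.SpecialLinearGroup.coe_mul, i1, i2, i3, i4,
      ← Matrix.SpecialLinearGroup.coe_inv]
    rw [mul_assoc, inv_mul_cancel_left, mul_inv_rev, inv_inv]
  have hp (a b : Fin 2) : (fun g : G => ((orbitMap g).1 (i + 1) * (orbitMap g).1 (i + 2)) a b) ∈
      matrixSpan (i + 1) * matrixSpan (i + 2) := by
    have : (fun g : G => ((orbitMap g).1 (i + 1) * (orbitMap g).1 (i + 2)) a b) =
        ∑ c, (fun g : G => (orbitMap g).1 (i + 1) a c) * fun g => (orbitMap g).1 (i + 2) c b := by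
      funext g
      rw [Matrix.mul_apply, Finset.sum_apply]
      rfl
    rw [this]
    exact sum_mem fun c _ => Submodule.mul_mem_mul (Submodule.subset_span ⟨a, c, rfl⟩)
      (Submodule.subset_span ⟨c, b, rfl⟩)
  have hn (a b : Fin 2) := neg_mem (hp a b)
  rw [matrixSpan, Submodule.span_le]
  rintro _ ⟨a, b, rfl⟩
  simp only [hmul, Matrix.adjugate_fin_two]
  fin_cases a <;> fin_cases b
  · exact hp 1 1
  · exact hn 0 1
  · exact hn 1 0
  · exact hp 0 0

/-- The determinant of each homogeneous coordinate equals `1` along the orbit. -/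
theorem one_le_matrixSpan_sq (i : Fin 3) : 1 ≤ matrixSpan i * matrixSpan i := by
  have he (a b : Fin 2) : (fun g : G => (orbitMap g).1 i a b) ∈ matrixSpan i :=
    Submodule.subset_span ⟨a, b, rfl⟩
  rw [Submodule.one_le]
  have : (1 : G → ℂ) = (fun g : G => (orbitMap g).1 i 0 0) * (fun g : G => (orbitMap g).1 i 1 1) -
      (fun g : G => (orbitMap g).1 i 0 1) * (fun g : G => (orbitMap g).1 i 1 0) := by
    funext g
    have := (g (i + 1) * (g (i + 2))⁻¹).2
    rw [Matrix.det_fin_two] at this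
    exact this.symm
  rw [this]
  exact sub_mem (Submodule.mul_mem_mul (he _ _) (he _ _)) (Submodule.mul_mem_mul (he _ _) (he _ _))

/-- If `M ≤ N P`, `N ≤ P M`, `P ≤ M N`, and `1 ≤ M ^ 2, N ^ 2, P ^ 2`, then the products of powers
of `M`, `N`, `P` increase with the weights of the exponents. -/
theorem pow_mul_pow_mul_pow_le {A : Type*} [CommSemiring A] [Algebra ℂ A] {M N P : Submodule ℂ A}
    (hM : M ≤ N * P) (hN : N ≤ P * M) (hP : P ≤ M * N) (hM1 : 1 ≤ M * M) (hN1 : 1 ≤ N * N)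
    (hP1 : 1 ≤ P * P) (n : ℕ) : ∀ a b c a' b' c' x y z : ℕ, x + y + z = n →
      b' + c' = b + c + 2 * x → c' + a' = c + a + 2 * y → a' + b' = a + b + 2 * z →
        M ^ a * N ^ b * P ^ c ≤ M ^ a' * N ^ b' * P ^ c' := by
  induction n using Nat.strong_induction_on with
  | _ n ih =>
  intro a b c a' b' c' x y z hn h0 h1 h2
  have hcases : (x = 0 ∧ y = 0 ∧ z = 0) ∨ (0 < x ∧ 0 < a) ∨ (0 < y ∧ 0 < b) ∨ (0 < z ∧ 0 < c) ∨
      (0 < x ∧ 0 < y) ∨ (0 < y ∧ 0 < z) ∨ (0 < x ∧ 0 < z) := by omega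
  obtain ⟨rfl, rfl, rfl⟩ | ⟨hx, ha⟩ | ⟨hy, hb⟩ | ⟨hz, hc⟩ | ⟨hx, hy⟩ | ⟨hy, hz⟩ | ⟨hx, hz⟩ := hcases
  · obtain rfl : a' = a := by omega
    obtain rfl : b' = b := by omega
    obtain rfl : c' = c := by omega
    exact le_rfl
  · obtain ⟨a, rfl⟩ := Nat.exists_eq_succ_of_ne_zero ha.ne'
    calc M ^ (a + 1) * N ^ b * P ^ c = M * (M ^ a * N ^ b * P ^ c) := by ring
      _ ≤ (N * P) * (M ^ a * N ^ b * P ^ c) := mul_le_mul' hM le_rfl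
      _ = M ^ a * N ^ (b + 1) * P ^ (c + 1) := by ring
      _ ≤ _ := ih (n - 1) (by omega) _ _ _ _ _ _ (x - 1) y z (by omega) (by omega) (by omega)
          (by omega)
  · obtain ⟨b, rfl⟩ := Nat.exists_eq_succ_of_ne_zero hb.ne'
    calc M ^ a * N ^ (b + 1) * P ^ c = N * (M ^ a * N ^ b * P ^ c) := by ring
      _ ≤ (P * M) * (M ^ a * N ^ b * P ^ c) := mul_le_mul' hN le_rfl
      _ = M ^ (a + 1) * N ^ b * P ^ (c + 1) := by ring
      _ ≤ _ := ih (n - 1) (by omega) _ _ _ _ _ _ x (y - 1) z (by omega) (by omega) (by omega)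
          (by omega)
  · obtain ⟨c, rfl⟩ := Nat.exists_eq_succ_of_ne_zero hc.ne'
    calc M ^ a * N ^ b * P ^ (c + 1) = P * (M ^ a * N ^ b * P ^ c) := by ring
      _ ≤ (M * N) * (M ^ a * N ^ b * P ^ c) := mul_le_mul' hP le_rfl
      _ = M ^ (a + 1) * N ^ (b + 1) * P ^ c := by ring
      _ ≤ _ := ih (n - 1) (by omega) _ _ _ _ _ _ x y (z - 1) (by omega) (by omega) (by omega)
          (by omega)
  · calc M ^ a * N ^ b * P ^ c = 1 * (M ^ a * N ^ b * P ^ c) := (one_mul _).symm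
      _ ≤ (P * P) * (M ^ a * N ^ b * P ^ c) := mul_le_mul' hP1 le_rfl
      _ = M ^ a * N ^ b * P ^ (c + 2) := by ring
      _ ≤ _ := ih (n - 2) (by omega) _ _ _ _ _ _ (x - 1) (y - 1) z (by omega) (by omega)
          (by omega) (by omega)
  · calc M ^ a * N ^ b * P ^ c = 1 * (M ^ a * N ^ b * P ^ c) := (one_mul _).symm
      _ ≤ (M * M) * (M ^ a * N ^ b * P ^ c) := mul_le_mul' hM1 le_rfl
      _ = M ^ (a + 2) * N ^ b * P ^ c := by ring
      _ ≤ _ := ih (n - 2) (by omega) _ _ _ _ _ _ x (y - 1) (z - 1) (by omega) (by omega)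
          (by omega) (by omega)
  · calc M ^ a * N ^ b * P ^ c = 1 * (M ^ a * N ^ b * P ^ c) := (one_mul _).symm
      _ ≤ (N * N) * (M ^ a * N ^ b * P ^ c) := mul_le_mul' hN1 le_rfl
      _ = M ^ a * N ^ (b + 2) * P ^ c := by ring
      _ ≤ _ := ih (n - 2) (by omega) _ _ _ _ _ _ (x - 1) y (z - 1) (by omega) (by omega)
          (by omega) (by omega)

/-- The multihomogeneous polynomials in the homogeneous coordinates increase with the weight of the
multidegree. -/
theorem sectionPart_mono {d e : Fin 3 → ℕ} (h : EvenLE (weight d) (weight e)) :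
    sectionPart d ≤ sectionPart e := by
  obtain ⟨x, hx⟩ := h 0
  obtain ⟨y, hy⟩ := h 1
  obtain ⟨z, hz⟩ := h 2
  simp only [weight, Fin.isValue, zero_add, Fin.reduceAdd] at hx hy hz
  rw [sectionPart, sectionPart, Fin.prod_univ_three, Fin.prod_univ_three]
  exact pow_mul_pow_mul_pow_le (matrixSpan_le_mul 0) (matrixSpan_le_mul 1) (matrixSpan_le_mul 2)
    (one_le_matrixSpan_sq 0) (one_le_matrixSpan_sq 1) (one_le_matrixSpan_sq 2) _ _ _ _ _ _ _ x y z
    rfl hx hy hz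

/-- An invariant function of multidegree `m` in the three matrices belongs to `Γ(m)`. -/
theorem mem_map_Gam {m : Fin 3 → ℕ} {f : G → ℂ} (hf : f ∈ degreePart m)
    (hinv : ∀ (g : G) (h : SL2), f (fun i => g i * h) = f g) :
    f ∈ (Gam m).map invRing.val.toLinearMap := by
  rw [map_Gam]
  exact mem_iSup_range_of_invariant (S := {n | EvenLE n m}) (degreePart_le m hf) hinv

/-- `Γ(m)`, `m` the weight of `d`, consists of the polynomials of multidegree `d` in the homogeneous
coordinates. -/
theorem map_Gam_weight (d : Fin 3 → ℕ) :
    (Gam (weight d)).map invRing.val.toLinearMap = sectionPart d := by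
  apply le_antisymm
  · rw [map_Gam]
    exact iSup_le fun e => (bracketPart_le e.1).trans (sectionPart_mono e.2)
  · intro f hf
    exact mem_map_Gam (sectionPart_le_degreePart d hf) (apply_mul_of_mem_sectionPart hf)

theorem weight_add (d e : Fin 3 → ℕ) : weight (d + e) = weight d + weight e := by
  funext i
  simp only [weight, Pi.add_apply]
  ring

/-- The product formula for the modules `Γ(m)`. -/
theorem Gam_mul_Gam (d e : Fin 3 → ℕ) :
    Gam (weight d) * Gam (weight e) = Gam (weight (d + e)) := by
  apply map_val_injective
  rw [Submodule.map_mul, map_Gam_weight, map_Gam_weight, map_Gam_weight, sectionPart_mul]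

/-! ### Sections and their restrictions to the open orbit -/

/-- The restriction to the open orbit as a homomorphism of algebras. -/
def pullbackHom : (ConeX → ℂ) →ₐ[ℂ] (G → ℂ) :=
  AlgHom.ofLinearMap pullback rfl fun _ _ => rfl

theorem exists_eq_smul_of_isCoord {A B : Fin 3 → Mat} {x : Fin 3 → ℙ ℂ Mat} (hA : IsCoord A x)
    (hB : IsCoord B x) : ∃ t : Fin 3 → ℂ, (∀ i, t i ≠ 0) ∧ ∀ i, B i = t i • A i := by
  have h (i : Fin 3) : ∃ a : ℂˣ, a • A i = B i := by
    obtain ⟨ha, ea⟩ := hA i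
    obtain ⟨hb, eb⟩ := hB i
    exact (Projectivization.mk_eq_mk_iff ℂ _ _ hb ha).1 (eb.trans ea.symm)
  choose a ha using h
  exact ⟨fun i => a i, fun i => (a i).ne_zero, fun i => (ha i).symm⟩

/-- A section vanishing on the open orbit vanishes: its local numerators vanish on the orbit where
the denominator does not, hence on `X`, the closure of the orbit. -/
theorem eq_zero_of_pullback_eq_zero {d : Fin 3 → ℕ} {s : ConeX → ℂ} (hs : s ∈ sectionsX d)
    (h : pullback s = 0) : s = 0 := by
  funext A
  obtain ⟨p, q, hq, hpq⟩ := hs.2 A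
  obtain ⟨x, hx, hA⟩ := A.2
  have h0 : evalTriple A.1 (p * q) = 0 := by
    refine hx _ (fun y hy B hB => ?_) A.1 hA
    obtain ⟨g, rfl⟩ := hy
    obtain ⟨t, -, ht⟩ := exists_eq_smul_of_isCoord
      (fun i => ⟨SL2.coe_ne_zero (g (i + 1) * (g (i + 2))⁻¹), rfl⟩ : IsCoord (orbitMap g).1 _) hB
    let B' : ConeX := ⟨B, _, fun _ hp A hA => hp _ ⟨g, rfl⟩ A hA, hB⟩
    have h1 : s B' = 0 := by
      rw [hs.1 (orbitMap g) B' t ht, show s (orbitMap g) = 0 from congrFun h g, mul_zero]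
    by_cases hqB : evalTriple B q = 0
    · simp only [evalTriple, map_mul] at hqB ⊢
      rw [hqB, mul_zero]
    · have h2 := hpq B' hqB
      rw [h1, eq_comm, div_eq_zero_iff] at h2
      have h3 := h2.resolve_right hqB
      simp only [evalTriple, map_mul] at h3 ⊢
      rw [show MvPolynomial.eval (fun v => B v.1 v.2.1 v.2.2) p = 0 from h3, zero_mul]
  have h1 : evalTriple A.1 p = 0 := by
    simp only [evalTriple, map_mul] at h0 hq ⊢
    exact (mul_eq_zero.1 h0).resolve_right hq
  rw [hpq A hq, h1, zero_div]
  rfl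

theorem injOn_pullback (d : Fin 3 → ℕ) :
    Set.InjOn pullback (sectionsX d : Set (ConeX → ℂ)) := by
  intro s hs s' hs' h
  refine sub_eq_zero.1 (eq_zero_of_pullback_eq_zero (sub_mem hs hs') ?_)
  rw [map_sub, h, sub_self]

theorem sectionsX_mul_le (d e : Fin 3 → ℕ) : sectionsX d * sectionsX e ≤ sectionsX (d + e) := by
  refine Submodule.mul_le.2 ?_
  rintro s ⟨hs, rs⟩ s' ⟨hs', rs'⟩
  refine ⟨fun A B t ht => ?_, fun A => ?_⟩
  · simp only [Pi.mul_apply, hs A B t ht, hs' A B t ht, Pi.add_apply, pow_add,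
      Finset.prod_mul_distrib]
    ring
  · obtain ⟨p, q, hq, h⟩ := rs A
    obtain ⟨p', q', hq', h'⟩ := rs' A
    refine ⟨p * p', q * q', ?_, fun B hB => ?_⟩
    · simpa [evalTriple] using And.intro hq hq'
    · have hB' : evalTriple B.1 q ≠ 0 ∧ evalTriple B.1 q' ≠ 0 := by
        simpa [evalTriple] using hB
      rw [Pi.mul_apply, h B hB'.1, h' B hB'.2]
      simp only [evalTriple, map_mul]
      rw [div_mul_div_comm]

/-- The entries of the `i`-th homogeneous coordinate are sections. -/
theorem entry_mem_sectionsX (i : Fin 3) (a b : Fin 2) :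
    (fun A : ConeX => A.1 i a b) ∈ sectionsX (Pi.single i 1) := by
  refine ⟨fun A B t ht => ?_, fun A => ⟨MvPolynomial.X (i, a, b), 1, ?_, fun B _ => ?_⟩⟩
  · have : ∏ j, t j ^ (Pi.single i 1 : Fin 3 → ℕ) j = t i := by
      rw [Finset.prod_eq_single i (fun j _ hj => by rw [Pi.single_eq_of_ne hj, pow_zero])
        (fun h => absurd (Finset.mem_univ i) h), Pi.single_eq_same, pow_one]
    simp only [this, ht, Matrix.smul_apply, smul_eq_mul]
  · simp [evalTriple]
  · simp [evalTriple]

theorem one_le_sectionsX : 1 ≤ sectionsX 0 := by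
  rw [Submodule.one_le]
  exact ⟨fun _ _ _ _ => by simp, fun _ => ⟨1, 1, by simp [evalTriple], by simp [evalTriple]⟩⟩

/-- The multihomogeneous polynomials in the homogeneous coordinates are sections. -/
theorem sectionPart_le_map (d : Fin 3 → ℕ) : sectionPart d ≤ (sectionsX d).map pullback := by
  have h1 (i : Fin 3) : matrixSpan i ≤ (sectionsX (Pi.single i 1)).map pullback := by
    rw [matrixSpan, Submodule.span_le]
    rintro _ ⟨a, b, rfl⟩
    exact ⟨_, entry_mem_sectionsX i a b, rfl⟩
  have hmul (d e : Fin 3 → ℕ) : (sectionsX d).map pullback * (sectionsX e).map pullback ≤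
      (sectionsX (d + e)).map pullback := by
    have := Submodule.map_mul (sectionsX d) (sectionsX e) pullbackHom
    exact this.symm.le.trans (Submodule.map_mono (sectionsX_mul_le d e))
  have h2 (i : Fin 3) (k : ℕ) :
      matrixSpan i ^ k ≤ (sectionsX (Pi.single i k)).map pullback := by
    induction k with
    | zero =>
      rw [pow_zero, Pi.single_zero, Submodule.one_le]
      exact ⟨1, Submodule.one_le.1 one_le_sectionsX, rfl⟩
    | succ k ih =>
      rw [pow_succ, Pi.single_add]
      exact (mul_le_mul' ih (h1 i)).trans (hmul _ _)
  have hd : Pi.single 0 (d 0) + Pi.single 1 (d 1) + Pi.single 2 (d 2) = d := by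
    funext i
    fin_cases i <;> simp
  rw [sectionPart, Fin.prod_univ_three]
  refine (mul_le_mul' ((mul_le_mul' (h2 0 _) (h2 1 _)).trans (hmul _ _)) (h2 2 _)).trans
    ((hmul _ _).trans ?_)
  rw [hd]

/-! ### Polynomials on triples of matrices -/

/-- The triple `(A₁ adj A₂, A₂ adj A₀, A₀ adj A₁)`. On `G` it is the triple of homogeneous
coordinates of a point of the open orbit. -/
def adjTriple (A : Fin 3 → Mat) : Fin 3 → Mat := fun i => A (i + 1) * (A (i + 2)).adjugate

theorem adjTriple_smul (c : Fin 3 → ℂ) (A : Fin 3 → Mat) (i : Fin 3) :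
    adjTriple (fun j => c j • A j) i = (c (i + 1) * c (i + 2)) • adjTriple A i := by
  simp [adjTriple, Matrix.adjugate_smul, mul_smul, smul_comm (c (i + 1))]

theorem adjTriple_coe (g : G) : adjTriple (fun i => (g i).1) = (orbitMap g).1 := by
  funext i
  ext a b
  exact (orbitMap_apply g i a b).symm

/-- The `i`-th generic matrix. -/
def genericMat (i : Fin 3) : Matrix (Fin 2) (Fin 2) TriplePoly :=
  Matrix.of fun a b => MvPolynomial.X (i, a, b)

/-- The substitution of `adjTriple` into polynomials. -/
def adjSubst : TriplePoly →ₐ[ℂ] TriplePoly :=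
  MvPolynomial.aeval fun v =>
    (genericMat (v.1 + 1) * (genericMat (v.1 + 2)).adjugate) v.2.1 v.2.2

theorem evalTriple_adjSubst (A : Fin 3 → Mat) (p : TriplePoly) :
    evalTriple A (adjSubst p) = evalTriple (adjTriple A) p := by
  induction p using MvPolynomial.induction_on with
  | C c => simp [evalTriple, adjSubst]
  | add p q hp hq => simpa [evalTriple] using congrArg₂ (· + ·) hp hq
  | mul_X p v hp =>
    simp only [evalTriple, map_mul] at hp ⊢
    rw [hp, adjSubst, MvPolynomial.aeval_X, MvPolynomial.eval_X]
    congr 1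
    obtain ⟨i, a, b⟩ := v
    simp only [adjTriple, genericMat, Matrix.adjugate_fin_two]
    fin_cases a <;> fin_cases b <;> simp [Matrix.mul_apply, Fin.sum_univ_two]

/-- The determinant of the `i`-th generic matrix. -/
def detPoly (i : Fin 3) : TriplePoly := (genericMat i).det

theorem evalTriple_detPoly (A : Fin 3 → Mat) (i : Fin 3) :
    evalTriple A (detPoly i) = (A i).det := by
  simp [evalTriple, detPoly, genericMat, Matrix.det_fin_two]

theorem evalTriple_prod_detPoly (A : Fin 3 → Mat) :
    evalTriple A (∏ i, detPoly i) = ∏ i, (A i).det := by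
  simp only [← evalTriple_detPoly]
  exact map_prod _ _ _

theorem irreducible_detPoly (i : Fin 3) : Irreducible (detPoly i) := by
  have h : detPoly i = MvPolynomial.X (i, 0, 0) * MvPolynomial.X (i, 1, 1) +
      -(MvPolynomial.X (i, 0, 1) * MvPolynomial.X (i, 1, 0)) := by
    rw [detPoly, Matrix.det_fin_two, sub_eq_add_neg]
    rfl
  rw [h]
  apply MvPolynomial.irreducible_mul_X_add
  · exact MvPolynomial.X_ne_zero _
  · simp [MvPolynomial.vars_X]
  · intro hv
    rw [MvPolynomial.vars_neg] at hv
    have := MvPolynomial.vars_mul _ _ hv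
    simp [MvPolynomial.vars_X] at this
  · rw [IsRelPrime.neg_right_iff, MvPolynomial.X_prime.irreducible.isRelPrime_iff_not_dvd]
    rintro ⟨q, hq⟩
    have := congrArg (MvPolynomial.eval fun v => if v = (i, 0, 0) then (0 : ℂ) else 1) hq
    simp at this

theorem detPoly_ne_zero (i : Fin 3) : detPoly i ≠ 0 := (irreducible_detPoly i).ne_zero

/-- Triples of invertible matrices are dense. -/
theorem eq_of_evalTriple_eq {p q : TriplePoly}
    (h : ∀ A : Fin 3 → Mat, (∀ i, (A i).det ≠ 0) → evalTriple A p = evalTriple A q) : p = q := by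
  have h0 : (∏ i, detPoly i) * (p - q) = 0 := by
    refine MvPolynomial.funext fun x => ?_
    let A : Fin 3 → Mat := fun i => Matrix.of fun a b => x (i, a, b)
    change evalTriple A _ = evalTriple A 0
    by_cases hA : ∀ i, (A i).det ≠ 0
    · have := h A hA
      simp only [evalTriple, map_mul, map_sub, map_zero] at this ⊢
      rw [this, sub_self, mul_zero]
    · push Not at hA
      obtain ⟨i, hi⟩ := hA
      have := (evalTriple_prod_detPoly A).trans
        (Finset.prod_eq_zero (f := fun i => (A i).det) (Finset.mem_univ i) hi)
      simp only [evalTriple, map_mul, map_zero] at this ⊢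
      rw [this, zero_mul]
  refine sub_eq_zero.1 ((mul_eq_zero.1 h0).resolve_left ?_)
  exact Finset.prod_ne_zero_iff.2 fun i _ => detPoly_ne_zero i

/-- An invertible matrix is a multiple of a matrix of determinant `1`. -/
theorem exists_smul_SL2 {A : Mat} (hA : A.det ≠ 0) : ∃ (c : ℂ) (g : SL2), c ≠ 0 ∧ A = c • g.1 := by
  obtain ⟨c, hc⟩ := IsAlgClosed.exists_pow_nat_eq A.det (n := 2) two_pos
  have hc0 : c ≠ 0 := by
    rintro rfl
    exact hA (by rw [← hc]; simp)
  refine ⟨c, ⟨c⁻¹ • A, ?_⟩, hc0, ?_⟩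
  · rw [Matrix.det_smul, Fintype.card_fin, ← hc, ← mul_pow, inv_mul_cancel₀ hc0, one_pow]
  · exact (smul_inv_smul₀ hc0 A).symm

/-- The points `adjTriple A` belong to the closure of the cone over the open orbit: for invertible
matrices they are multiples of points of the orbit. -/
theorem evalTriple_adjTriple_of_vanishing {p : TriplePoly}
    (hp : ∀ y ∈ openOrbit, ∀ B, IsCoord B y → evalTriple B p = 0) (A : Fin 3 → Mat) :
    evalTriple (adjTriple A) p = 0 := by
  have h : adjSubst p = 0 := by
    refine eq_of_evalTriple_eq fun A hA => ?_
    rw [evalTriple_adjSubst]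
    choose c g hc hg using fun i => exists_smul_SL2 (hA i)
    have hB (i : Fin 3) : adjTriple A i = (c (i + 1) * c (i + 2)) • (orbitMap g).1 i := by
      rw [← adjTriple_coe, ← adjTriple_smul, ← funext hg]
    rw [hp _ ⟨g, rfl⟩ (adjTriple A) fun i => ?_]
    · simp [evalTriple]
    · have hne : adjTriple A i ≠ 0 := by
        rw [hB]
        exact smul_ne_zero (mul_ne_zero (hc _) (hc _))
          (SL2.coe_ne_zero (g (i + 1) * (g (i + 2))⁻¹))
      exact ⟨hne, (Projectivization.mk_eq_mk_iff' ℂ _ _ hne _).2 ⟨_, (hB i).symm⟩⟩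
  rw [← evalTriple_adjSubst, h]
  simp [evalTriple]

/-- The triple `adjTriple A` represents a point of `X` as soon as its entries are nonzero. -/
def adjCone (A : Fin 3 → Mat) (hA : ∀ i, adjTriple A i ≠ 0) : ConeX :=
  ⟨adjTriple A, fun i => Projectivization.mk ℂ (adjTriple A i) (hA i), by
    intro p hp B hB
    obtain ⟨t, ht, htB⟩ := exists_eq_smul_of_isCoord (fun i => ⟨hA i, rfl⟩) hB
    -- The scalars `t` are absorbed into `A`, by means of a square root.
    obtain ⟨r, hr⟩ := IsAlgClosed.exists_pow_nat_eq (t 0 * t 1 * t 2) (n := 2) two_pos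
    have hBA : B = adjTriple fun j => (r / t j) • A j := by
      funext i
      rw [htB, adjTriple_smul]
      congr 1
      have h0 := ht 0
      have h1 := ht 1
      have h2 := ht 2
      fin_cases i <;> simp <;> field_simp <;> rw [hr] <;> ring
    rw [hBA]
    exact evalTriple_adjTriple_of_vanishing hp _, fun i => ⟨hA i, rfl⟩⟩

/-! ### Extension of sections to the triples of invertible matrices -/

/-- A function on `U`, locally a quotient of polynomials there, coincides with a polynomial on the
open set `D ≠ 0`, if this set and `h ≠ 0` are contained in `U` and `D`, `h` have no common factor.
Indeed powers of `D` and of `h` are denominators of the function by the Nullstellensatz. -/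
theorem exists_polynomial_of_locally_quotient {σ : Type*} [Finite σ] {U : Set (σ → ℂ)}
    {F : (σ → ℂ) → ℂ}
    (hF : ∀ x ∈ U, ∃ p q : MvPolynomial σ ℂ, MvPolynomial.eval x q ≠ 0 ∧
      ∀ y ∈ U, MvPolynomial.eval y q * F y = MvPolynomial.eval y p)
    {D h : MvPolynomial σ ℂ} (hD : ∀ x, MvPolynomial.eval x D ≠ 0 → x ∈ U)
    (hh : ∀ x, MvPolynomial.eval x h ≠ 0 → x ∈ U) (hDh : IsRelPrime D h) (hD0 : D ≠ 0) :
    ∃ r : MvPolynomial σ ℂ, ∀ x, MvPolynomial.eval x D ≠ 0 → F x = MvPolynomial.eval x r := by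
  let I : Ideal (MvPolynomial σ ℂ) :=
    { carrier := {q | ∃ p, ∀ y ∈ U, MvPolynomial.eval y q * F y = MvPolynomial.eval y p}
      zero_mem' := ⟨0, fun y _ => by simp⟩
      add_mem' := by
        rintro q q' ⟨p, hp⟩ ⟨p', hp'⟩
        exact ⟨p + p', fun y hy => by rw [map_add, map_add, add_mul, hp y hy, hp' y hy]⟩
      smul_mem' := by
        rintro c q ⟨p, hp⟩
        exact ⟨c * p, fun y hy => by
          rw [smul_eq_mul, map_mul, map_mul, mul_assoc, hp y hy]⟩ }
  have hrad {f : MvPolynomial σ ℂ} (hf : ∀ x, MvPolynomial.eval x f ≠ 0 → x ∈ U) :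
      ∃ n, f ^ (n + 1) ∈ I := by
    have : f ∈ I.radical := by
      rw [← MvPolynomial.vanishingIdeal_zeroLocus_eq_radical (K := ℂ),
        MvPolynomial.mem_vanishingIdeal_iff]
      intro x hx
      by_contra hfx
      obtain ⟨p, q, hq, hpq⟩ := hF x (hf x hfx)
      exact hq (hx q ⟨p, hpq⟩)
    obtain ⟨n, hn⟩ := this
    exact ⟨n, by rw [pow_succ]; exact I.mul_mem_right _ hn⟩
  obtain ⟨n, p, hp⟩ := hrad hD
  obtain ⟨k, q, hq⟩ := hrad hh
  -- The identity `D ^ (n + 1) * q = h ^ (k + 1) * p` holds on `U`; multiplied by `D` it holds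
  -- everywhere.
  have heq : D ^ (n + 1) * q = h ^ (k + 1) * p := by
    apply mul_left_cancel₀ hD0
    refine MvPolynomial.funext fun x => ?_
    by_cases hx : MvPolynomial.eval x D = 0
    · simp only [map_mul, hx, zero_mul]
    · have h1 := hp x (hD x hx)
      have h2 := hq x (hD x hx)
      simp only [map_mul, map_pow] at h1 h2 ⊢
      rw [← h1, ← h2]
      ring
  obtain ⟨r, rfl⟩ : D ^ (n + 1) ∣ p :=
    (IsRelPrime.pow hDh).dvd_of_dvd_mul_left ⟨q, heq.symm⟩
  refine ⟨r, fun x hx => ?_⟩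
  have := hp x (hD x hx)
  rw [map_mul, map_pow] at this
  exact mul_left_cancel₀ (pow_ne_zero _ hx) this

/-- A polynomial that vanishes unless `adjTriple A` represents a point of `X`, and that is not
divisible by any of the determinants. -/
def entryPoly : TriplePoly := adjSubst (∏ i : Fin 3, MvPolynomial.X (i, 0, 0))

theorem evalTriple_entryPoly (A : Fin 3 → Mat) :
    evalTriple A entryPoly = ∏ i, adjTriple A i 0 0 := by
  rw [entryPoly, evalTriple_adjSubst]
  simp [evalTriple]

theorem isRelPrime_entryPoly : IsRelPrime (∏ i, detPoly i) entryPoly := by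
  refine IsRelPrime.prod_left fun i _ => ?_
  rw [(irreducible_detPoly i).isRelPrime_iff_not_dvd]
  rintro ⟨q, hq⟩
  -- At this triple the `i`-th determinant vanishes, whereas `entryPoly` does not.
  let A : Fin 3 → Mat := Function.update (fun _ => 1) i !![1, 1; 1, 1]
  have h := congrArg (evalTriple A) hq
  have h1 : evalTriple A (detPoly i * q) = 0 := by
    have h2 : evalTriple A (detPoly i) = 0 := by
      rw [evalTriple_detPoly]
      simp [A, Matrix.det_fin_two]
    simp only [evalTriple, map_mul] at h2 ⊢
    rw [h2, zero_mul]
  rw [h1, evalTriple_entryPoly, Fin.prod_univ_three] at h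
  revert h
  simp only [A, adjTriple]
  fin_cases i <;> simp [Matrix.adjugate_fin_two]

theorem adjTriple_ne_zero_of_det {A : Fin 3 → Mat} (hA : ∀ i, (A i).det ≠ 0) (i : Fin 3) :
    adjTriple A i ≠ 0 := by
  intro h
  have h1 : (adjTriple A i).det ≠ 0 := by
    rw [adjTriple, Matrix.det_mul, Matrix.det_adjugate]
    exact mul_ne_zero (hA _) (pow_ne_zero _ (hA _))
  rw [h] at h1
  simp at h1

/-- A section is given on the triples of invertible matrices by a polynomial. -/
theorem exists_polynomial_of_mem_sectionsX {d : Fin 3 → ℕ} {s : ConeX → ℂ}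
    (hs : s ∈ sectionsX d) : ∃ r : TriplePoly, ∀ A (hA : ∀ i, (A i).det ≠ 0),
      s (adjCone A (adjTriple_ne_zero_of_det hA)) = evalTriple A r := by
  classical
  let curry (x : Fin 3 × Fin 2 × Fin 2 → ℂ) : Fin 3 → Mat := fun i =>
    Matrix.of fun a b => x (i, a, b)
  let U : Set (Fin 3 × Fin 2 × Fin 2 → ℂ) := {x | ∀ i, adjTriple (curry x) i ≠ 0}
  let F (x : Fin 3 × Fin 2 × Fin 2 → ℂ) : ℂ := if hx : x ∈ U then s (adjCone (curry x) hx) else 0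
  have hF : ∀ x ∈ U, ∃ p q : TriplePoly, MvPolynomial.eval x q ≠ 0 ∧
      ∀ y ∈ U, MvPolynomial.eval y q * F y = MvPolynomial.eval y p := by
    intro x hx
    obtain ⟨p, q, hq, hpq⟩ := hs.2 (adjCone (curry x) hx)
    -- The second factor `q` makes the equation hold also at the zeros of the denominator.
    refine ⟨adjSubst (p * q), adjSubst (q * q), ?_, fun y hy => ?_⟩
    · change evalTriple (curry x) _ ≠ 0
      rw [evalTriple_adjSubst]
      simp only [evalTriple, map_mul]
      exact mul_ne_zero hq hq
    · change evalTriple (curry y) _ * _ = evalTriple (curry y) _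
      have hFy : F y = s (adjCone (curry y) hy) := dif_pos hy
      rw [evalTriple_adjSubst, evalTriple_adjSubst, hFy]
      by_cases hqy : evalTriple (adjTriple (curry y)) q = 0
      · simp only [evalTriple, map_mul] at hqy ⊢
        rw [hqy, mul_zero, mul_zero, zero_mul]
      · have h1 := hpq (adjCone (curry y) hy) hqy
        rw [h1]
        change _ * (evalTriple (adjTriple (curry y)) p / evalTriple (adjTriple (curry y)) q) = _
        simp only [evalTriple, map_mul] at hqy ⊢
        field_simp
  have hD (x : Fin 3 × Fin 2 × Fin 2 → ℂ) (hx : MvPolynomial.eval x (∏ i, detPoly i) ≠ 0) :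
      x ∈ U := by
    have h1 : ∏ i, (curry x i).det ≠ 0 := (evalTriple_prod_detPoly (curry x)).symm.trans_ne hx
    exact adjTriple_ne_zero_of_det fun i => Finset.prod_ne_zero_iff.1 h1 i (Finset.mem_univ i)
  have hh (x : Fin 3 × Fin 2 × Fin 2 → ℂ) (hx : MvPolynomial.eval x entryPoly ≠ 0) : x ∈ U := by
    have h1 : ∏ i, adjTriple (curry x) i 0 0 ≠ 0 :=
      (evalTriple_entryPoly (curry x)).symm.trans_ne hx
    intro i h0
    refine Finset.prod_ne_zero_iff.1 h1 i (Finset.mem_univ i) ?_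
    rw [h0, Matrix.zero_apply]
  obtain ⟨r, hr⟩ := exists_polynomial_of_locally_quotient hF hD hh isRelPrime_entryPoly
    (Finset.prod_ne_zero_iff.2 fun i _ => detPoly_ne_zero i)
  refine ⟨r, fun A hA => ?_⟩
  let x : Fin 3 × Fin 2 × Fin 2 → ℂ := fun v => A v.1 v.2.1 v.2.2
  have hxU : x ∈ U := adjTriple_ne_zero_of_det hA
  have h1 := hr x ((evalTriple_prod_detPoly A).trans_ne
    (Finset.prod_ne_zero_iff.2 fun i _ => hA i))
  exact (dif_pos hxU).symm.trans h1

/-- A polynomial that is homogeneous of degree `m i` in the `i`-th matrix, as a function, contains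
only monomials of multidegree `m`. -/
theorem sum_eq_of_homogeneous {m : Fin 3 → ℕ} {r : TriplePoly}
    (hr : ∀ (t : Fin 3 → ℂ) (A : Fin 3 → Mat), (∀ i, t i ≠ 0) → (∀ i, (A i).det ≠ 0) →
      evalTriple (fun i => t i • A i) r = (∏ i, t i ^ m i) * evalTriple A r)
    {e : Fin 3 × Fin 2 × Fin 2 →₀ ℕ} (he : e ∈ r.support) (i : Fin 3) :
    ∑ v, e (i, v) = m i := by
  classical
  -- Multiplication of the `i`-th matrix by `2` multiplies `r` by `2 ^ m i`, and its monomials by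
  -- the powers of `2` given by their degrees.
  let t : Fin 3 → ℂ := Function.update 1 i 2
  let S : TriplePoly →ₐ[ℂ] TriplePoly :=
    MvPolynomial.aeval fun v => MvPolynomial.C (t v.1) * MvPolynomial.X v
  have ht : ∀ j, t j ≠ 0 := by
    intro j
    by_cases h : j = i
    · subst h; simp [t]
    · simp [t, h]
  have hprod (k : Fin 3 → ℕ) : ∏ j, t j ^ k j = 2 ^ k i := by
    rw [Finset.prod_eq_single i]
    · simp [t]
    · intro j _ hj
      simp [t, hj]
    · simp
  have hS : S r = MvPolynomial.C (2 ^ m i) * r := by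
    refine eq_of_evalTriple_eq fun A hA => ?_
    have h1 (p : TriplePoly) : evalTriple A (S p) = evalTriple (fun i => t i • A i) p := by
      induction p using MvPolynomial.induction_on with
      | C c => simp [evalTriple, S]
      | add p q hp hq => simpa [evalTriple] using congrArg₂ (· + ·) hp hq
      | mul_X p v hp =>
        simp only [evalTriple, map_mul] at hp ⊢
        rw [hp]
        simp [S]
    rw [h1, hr t A ht hA, hprod]
    simp [evalTriple]
  have hcoeff (p : TriplePoly) : (S p).coeff e = 2 ^ (∑ v, e (i, v)) * p.coeff e := by
    induction p using MvPolynomial.induction_on' with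
    | add p q hp hq => rw [map_add, MvPolynomial.coeff_add, hp, hq, MvPolynomial.coeff_add, mul_add]
    | monomial k c =>
      have h1 : S (MvPolynomial.monomial k c) =
          MvPolynomial.C (∏ j, t j ^ ∑ v, k (j, v)) * MvPolynomial.monomial k c := by
        rw [MvPolynomial.aeval_monomial, MvPolynomial.monomial_eq (s := k), Finsupp.prod_fintype,
          Finsupp.prod_fintype]
        · simp only [mul_pow, Finset.prod_mul_distrib, map_prod, map_pow,
            ← Finset.prod_pow_eq_pow_sum, Fintype.prod_prod_type]
          rw [MvPolynomial.algebraMap_eq]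
          ring
        · simp
        · simp
      rw [h1, hprod, MvPolynomial.coeff_C_mul, MvPolynomial.coeff_monomial]
      split_ifs with hk
      · rw [hk]
      · simp
  have h1 := hcoeff r
  rw [hS, MvPolynomial.coeff_C_mul] at h1
  have h2 := mul_right_cancel₀ (MvPolynomial.mem_support_iff.1 he) h1
  have h3 : (2 : ℕ) ^ m i = 2 ^ ∑ v, e (i, v) := by exact_mod_cast h2
  exact (Nat.pow_right_injective le_rfl h3).symm

theorem prod_mem_prod {ι A : Type*} [CommSemiring A] [Algebra ℂ A] {s : Finset ι}
    {M : ι → Submodule ℂ A} {f : ι → A} (h : ∀ i ∈ s, f i ∈ M i) : ∏ i ∈ s, f i ∈ ∏ i ∈ s, M i := by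
  classical
  induction s using Finset.induction_on with
  | empty => simp [Submodule.one_le.1 le_rfl]
  | insert i s hi ih =>
    rw [Finset.prod_insert hi, Finset.prod_insert hi]
    exact Submodule.mul_mem_mul (h i (Finset.mem_insert_self i s))
      (ih fun j hj => h j (Finset.mem_insert_of_mem hj))

theorem mem_degreePart_of_support {m : Fin 3 → ℕ} {r : TriplePoly}
    (hr : ∀ e ∈ r.support, ∀ i, ∑ v, e (i, v) = m i) :
    (fun g : G => evalTriple (fun i => (g i).1) r) ∈ degreePart m := by
  have h1 : (fun g : G => evalTriple (fun i => (g i).1) r) =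
      ∑ e ∈ r.support, r.coeff e • ∏ i, ∏ v, (fun g : G => (g i).1 v.1 v.2) ^ e (i, v) := by
    funext g
    simp only [evalTriple, MvPolynomial.eval_eq', Finset.sum_apply, Pi.smul_apply,
      Finset.prod_apply, Pi.pow_apply, smul_eq_mul, Fintype.prod_prod_type]
  rw [h1]
  refine sum_mem fun e he => Submodule.smul_mem _ _ ?_
  have h2 (i : Fin 3) : ∏ v, (fun g : G => (g i).1 v.1 v.2) ^ e (i, v) ∈ entrySpan i ^ m i := by
    rw [← hr e he i, ← Finset.prod_pow_eq_pow_sum]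
    have h3 (v : Fin 2 × Fin 2) : (fun g : G => (g i).1 v.1 v.2) ∈ entrySpan i :=
      Submodule.subset_span ⟨v.1, v.2, rfl⟩
    exact prod_mem_prod fun v _ => Submodule.pow_mem_pow _ (h3 v) _
  exact prod_mem_prod fun i _ => h2 i

/-- The restriction of a section to the orbit is an invariant polynomial of multidegree the weight
of `d` in the three matrices. -/
theorem map_sectionsX_le (d : Fin 3 → ℕ) : (sectionsX d).map pullback ≤ sectionPart d := by
  rintro _ ⟨s, hs, rfl⟩
  obtain ⟨r, hr⟩ := exists_polynomial_of_mem_sectionsX hs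
  have hsr (g : G) : s (orbitMap g) = evalTriple (fun i => (g i).1) r := by
    have hg : ∀ i, ((g i).1 : Mat).det ≠ 0 := fun i => by rw [(g i).2]; exact one_ne_zero
    rw [← hr _ hg]
    exact congrArg s (Subtype.ext (adjTriple_coe g).symm)
  rw [← map_Gam_weight]
  refine mem_map_Gam (m := weight d) ?_ fun g h => ?_
  · have h1 : pullback s = fun g : G => evalTriple (fun i => (g i).1) r := funext hsr
    rw [h1]
    refine mem_degreePart_of_support fun e he => sum_eq_of_homogeneous (fun t A ht hA => ?_) he
    have htA : ∀ i, (t i • A i).det ≠ 0 := fun i => by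
      rw [Matrix.det_smul]
      exact mul_ne_zero (pow_ne_zero _ (ht i)) (hA i)
    rw [← hr _ hA, ← hr _ htA, hs.1 (adjCone A (adjTriple_ne_zero_of_det hA)) _
      (fun i => t (i + 1) * t (i + 2)) fun i => adjTriple_smul t A i]
    congr 1
    simp only [Fin.prod_univ_three, weight, Fin.isValue, zero_add, Fin.reduceAdd]
    ring
  · exact congrArg s (orbitMap_mul g h)

theorem map_sectionsX (d : Fin 3 → ℕ) : (sectionsX d).map pullback = sectionPart d :=
  le_antisymm (map_sectionsX_le d) (sectionPart_le_map d)

/-- The multiplication of sections is surjective. -/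
theorem sectionsX_mul (d e : Fin 3 → ℕ) : sectionsX d * sectionsX e = sectionsX (d + e) := by
  refine le_antisymm (sectionsX_mul_le d e) fun s hs => ?_
  have h1 : (sectionsX d * sectionsX e).map pullback = sectionPart (d + e) := by
    rw [← sectionPart_mul, ← map_sectionsX, ← map_sectionsX]
    exact Submodule.map_mul (sectionsX d) (sectionsX e) pullbackHom
  obtain ⟨s', hs', h⟩ := SetLike.le_def.1 h1.ge
    (map_sectionsX_le (d + e) (Submodule.mem_map_of_mem hs))
  rwa [← injOn_pullback _ (sectionsX_mul_le d e hs') hs h]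

end TripleSL2

end

theorem mainTheorem6 :
    -- the invariant ring is the direct sum of its submodules `V(m)`, with `m` in the semigroup
    DirectSum.IsInternal
      (fun m : TripleSL2.tensorSemigroup => (TripleSL2.component m.1).toSubmodule) ∧
    (∀ m ∈ TripleSL2.tensorSemigroup, Nonempty
      ((TripleSL2.component m).toRepresentation.Equiv (TripleSL2.simpleG m))) ∧
    -- the product formula
    (∀ m ∈ TripleSL2.tensorSemigroup, ∀ n ∈ TripleSL2.tensorSemigroup,
      m + n ∈ TripleSL2.tensorSemigroup ∧
        TripleSL2.Gam m * TripleSL2.Gam n = TripleSL2.Gam (m + n)) ∧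
    -- the weights of the bundles `𝒪(d)` on `X` are the elements of the semigroup, and
    -- restriction to the open orbit identifies the sections on `X` with the spaces `Γ`
    Set.range TripleSL2.weight = TripleSL2.tensorSemigroup ∧
    (∀ d : Fin 3 → ℕ,
      Set.InjOn TripleSL2.pullback (TripleSL2.sectionsX d : Set (TripleSL2.ConeX → ℂ)) ∧
      (TripleSL2.sectionsX d).map TripleSL2.pullback =
        (TripleSL2.Gam (TripleSL2.weight d)).map TripleSL2.invRing.val.toLinearMap) ∧
    -- the multiplication of sections on `X` is surjective
    (∀ d e : Fin 3 → ℕ,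
      TripleSL2.sectionsX d * TripleSL2.sectionsX e = TripleSL2.sectionsX (d + e)) := by
  refine ⟨TripleSL2.isInternal_component, fun m hm => ?_, fun m hm n hn => ?_,
    TripleSL2.range_weight,
    fun d => ⟨TripleSL2.injOn_pullback d,
      (TripleSL2.map_sectionsX d).trans (TripleSL2.map_Gam_weight d).symm⟩,
    TripleSL2.sectionsX_mul⟩
  · rw [← TripleSL2.range_weight] at hm
    obtain ⟨d, rfl⟩ := hm
    exact TripleSL2.nonempty_component_equiv d
  · rw [← TripleSL2.range_weight] at hm hn ⊢
    obtain ⟨d, rfl⟩ := hm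
    obtain ⟨e, rfl⟩ := hn
    rw [TripleSL2.Gam_mul_Gam, ← TripleSL2.weight_add]
    exact ⟨⟨d + e, rfl⟩, rfl⟩
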